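/- Let $N\ge 2$, $\mathbf{p}\in[2,\infty)$, $s\in(\tfrac12,1)$. Let $\alpha_{\mathbf p}\in(0,\frac{\pi}{2}]$ be the angle such that the spherical cup $A_{\mathbf p}=\{|z|=1,\ \angle(e_1,z)<\alpha_{\mathbf p}\}\subset\mathbb{R}^N$ satisfies $\mathbf{p}-1=\int_{A_{\mathbf p}}\langle z,e_1\rangle^2\,d\sigma\big/\int_{A_{\mathbf p}}\langle z,e_2\rangle^2\,d\sigma$, and let $T=\{z\in\mathbb{R}^N:\ \angle(e_1,z)<\alpha_{\mathbf p},\ |z|>1\}$. Let $\mathbb{P}$ be the law of an i.i.d. sequence $(z_n,s_n)_{n\ge1}$, where $z_n$ is distributed on $T$ according to the normalisation of the measure $|z|^{-N-2s}\,dz$, and $s_n$ is uniform on $\{1,2\}$ and independent of $z_n$. A strategy is a sequence of Borel maps $\sigma^n$, $n\ge 0$, assigning a unit vector to each finite history $(x_0,(x_1,z_1,s_1),\dots,(x_n,z_n,s_n))$. For a starting point $x_0$, $\epsilon>0$, and strategies $\sigma_I,\sigma_{II}$ of Players I and II, the game position is given by $X_0=x_0$ and $$X_n=X_{n-1}+\epsilon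 R_{y}z_n,\qquad y=\sigma_I^{n-1}\ \text{if } s_n=1,\qquad y=\sigma_{II}^{n-1}\ \text{if } s_n=2,$$ the strategies being evaluated at the history of the first $n-1$ rounds. Here $R_y\in SO(N)$ is the rotation in the plane spanned by $e_1$ and $y$ with $R_ye_1=y$ ($R_{e_1}=\mathrm{Id}$; for $y=-e_1$ the plane of $e_1,e_2$ is used). For a set $\mathcal{D}$, let $\tau=\min\{n\ge1:\ X_n\notin\mathcal{D}\}$, with $\tau=\infty$ if there is no such $n$. **Theorem.** Let $C=\{z:\ \angle(v,z)<\beta,\ 0<|z|<h\}$ be a finite cone, where $|v|=1$, $\beta\in(0,\pi)$, $h>0$. There exists a constant $\bar\theta<1$, depending only on $N,\mathbf{p},s$ and $C$, such that the following holds for every open, bounded set $\mathcal{D}\subset\mathbb{R}^N$ with the property that for each $x\in\partial\mathcal{D}$ there is a rotation $S_x\in SO(N)$ with $x+S_xC\subset\mathbb{R}^N\setminus\mathcal{D}$. For every $\delta>0$ there exist $\hat\delta\in(0,\delta)$ and $\hat\epsilon>0$ such that for all $\epsilon\in(0,\hat\epsilon)$, all $x\in\partial\mathcal{D}$ and all $x_0\in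 B_{\hat\delta}(x)\cap\mathcal{D}$ there exists a strategy $\sigma_{I}$ of Player I such that for all strategies $\sigma_{II}$ of Player II: $$\mathbb{P}\big(\exists\, n<\tau:\ X_n\notin B_\delta(x)\big)\le\bar\theta .$$ -/

import Mathlib

open MeasureTheory ProbabilityTheory

namespace FracTug

/-- The space `ℝ^N` with its Euclidean norm. -/
abbrev E (N : ℕ) : Type := EuclideanSpace ℝ (Fin N)

/-- The coordinate vectors, counted from zero: `coordVec N 0` is the vector written `e₁` in print
and `coordVec N 1` is `e₂` (the value is `0` if `N ≤ k`, which does not occur below for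
`k = 0, 1` and `2 ≤ N`). -/
noncomputable def coordVec (N k : ℕ) : E N :=
  WithLp.toLp 2 (fun i : Fin N => if i.val = k then (1 : ℝ) else 0)

/-- The normalising constant `C(N,s) = 4^s s Γ(N/2 + s) / (π^{N/2} Γ(1 - s))`. -/
noncomputable def fracConst (N : ℕ) (s : ℝ) : ℝ :=
  (4 : ℝ) ^ s * s * Real.Gamma ((N : ℝ) / 2 + s) /
    (Real.pi ^ ((N : ℝ) / 2) * Real.Gamma (1 - s))

/-- The measure `dμ_s^N(z) = C(N,s) |z|^{-N-2s} dz` on `ℝ^N`. -/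
noncomputable def fracMeasure (N : ℕ) (s : ℝ) : Measure (E N) :=
  (volume : Measure (E N)).withDensity
    (fun z => ENNReal.ofReal (fracConst N s / ‖z‖ ^ ((N : ℝ) + 2 * s)))

/-- The spherical cup `{z ; |z| = 1, ∠(e₁, z) < α}`, as a subset of the unit sphere. -/
def cap (N : ℕ) (α : ℝ) : Set (Metric.sphere (0 : E N) 1) :=
  {z | InnerProductGeometry.angle (coordVec N 0) (z : E N) < α}

/-- `∫ ⟨z, e⟩² dσ(z)` over the spherical cup of angle `α`, with `σ` the surface measure. -/
noncomputable def capMoment (N : ℕ) (α : ℝ) (e : E N) : ℝ :=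
  ∫ z in cap N α, (inner ℝ (z : E N) e) ^ 2 ∂((volume : Measure (E N)).toSphere)

/-- `α ∈ (0, π/2]` and `p - 1` is the quotient of the integrals of `⟨z,e₁⟩²` and `⟨z,e₂⟩²` over the
spherical cup of angle `α`. -/
def IsApertureAngle (N : ℕ) (p α : ℝ) : Prop :=
  α ∈ Set.Ioc 0 (Real.pi / 2) ∧
    p - 1 = capMoment N α (coordVec N 0) / capMoment N α (coordVec N 1)

open Classical in
/-- The angle `α_p`. For `2 ≤ N` and `2 ≤ p` there is exactly one angle with the property
`IsApertureAngle N p`, since the quotient of the two integrals decreases strictly from `∞` to `1` as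
the angle increases from `0` to `π/2`; so the default value in the second branch is never used. -/
noncomputable def apertureAngle (N : ℕ) (p : ℝ) : ℝ :=
  if h : ∃ α, IsApertureAngle N p α then h.choose else Real.pi / 2

/-- The truncated infinite cone `T_p^{1,∞} = {z ; ∠(e₁, z) < α_p, 1 < |z|}`. -/
def truncCone (N : ℕ) (p : ℝ) : Set (E N) :=
  {z | InnerProductGeometry.angle (coordVec N 0) z < apertureAngle N p ∧ 1 < ‖z‖}

open Classical in
/-- The rotation `R_{y, e₁} ∈ SO(N)` in the plane spanned by `e₁` and the unit vector `y` that takes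
`e₁` to `y`, written as the composition of the reflections in the hyperplanes orthogonal to `e₁`
(first) and to `e₁ + y`; it is the identity for `y = e₁`. For `y = -e₁`, where the plane is not
determined, the plane of `e₁` and `e₂` is taken. -/
noncomputable def rot {N : ℕ} (y : E N) : E N ≃ₗᵢ[ℝ] E N :=
  ((Submodule.span ℝ {coordVec N 0})ᗮ.reflection).trans
    ((Submodule.span ℝ
      {if y = -coordVec N 0 then coordVec N 1 else coordVec N 0 + y})ᗮ.reflection)

/-- One round of random data `(z, s)`; `true` is the outcome `s = 1` (direction chosen by Player I
is used), `false` is the outcome `s = 2` (direction chosen by Player II is used). The vector `z` has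
a law that is carried by `T_p^{1,∞}`, see `stepLaw`. -/
abbrev Outcome (N : ℕ) : Type := E N × Bool

/-- The probability `ℙ₁`: the normalisation of `μ_s^N` on `T_p^{1,∞}`, times the fair coin. -/
noncomputable def stepLaw (N : ℕ) (p s : ℝ) : Measure (Outcome N) :=
  ((fracMeasure N s)[|truncCone N p]).prod (uniformOn (Set.univ : Set Bool))

/-- The probability `ℙ` on `Ω`: the countable product of copies of `ℙ₁`. (The value `ω n` is the
random data of round `n + 1`.) -/
noncomputable def gameLaw (N : ℕ) (p s : ℝ) : Measure (ℕ → Outcome N) :=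
  Measure.infinitePi (fun _ : ℕ => stepLaw N p s)

/-- Finite histories `(x₀, (x₁, z₁, s₁), …, (xₙ, zₙ, sₙ))`. -/
abbrev History (N n : ℕ) : Type := E N × (Fin n → E N × Outcome N)

/-- A strategy: for each `n` a Borel function of the history with values in the unit vectors. -/
structure Strategy (N : ℕ) where
  dir : ∀ n : ℕ, History N n → Metric.sphere (0 : E N) 1
  measurable_dir : ∀ n : ℕ, Measurable (dir n)

/-- The current game position recorded in a history. -/
def History.pos {N : ℕ} : {n : ℕ} → History N n → E N
  | 0, H => H.1
  | n + 1, H => (H.2 (Fin.last n)).1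

/-- The history of the first `n` rounds of the game with parameter `ε` and starting point `x`. In
round `n + 1` the position is advanced by `ε R_{y, e₁} z`, where `(z, s) = ω n` and `y` is the
direction chosen by Player I if `s = 1` and the one chosen by Player II if `s = 2`. -/
noncomputable def history {N : ℕ} (ε : ℝ) (x : E N) (σI σII : Strategy N) (ω : ℕ → Outcome N) :
    (n : ℕ) → History N n
  | 0 => (x, Fin.elim0)
  | n + 1 =>
    let H := history ε x σI σII ω n
    let y : Metric.sphere (0 : E N) 1 := if (ω n).2 = true then σI.dir n H else σII.dir n H
    (x, Fin.snoc H.2 (H.pos + ε • rot (y : E N) (ω n).1, ω n))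

/-- The game position `X_n^{ε, x, σ_I, σ_II}`. -/
noncomputable def position {N : ℕ} (ε : ℝ) (x : E N) (σI σII : Strategy N) (n : ℕ)
    (ω : ℕ → Outcome N) : E N :=
  (history ε x σI σII ω n).pos

/-- The exit time `τ = min {n ≥ 1 ; X_n ∉ D}`, with value `∞` if there is no such `n`. -/
noncomputable def exitTime {N : ℕ} (D : Set (E N)) (ε : ℝ) (x : E N) (σI σII : Strategy N)
    (ω : ℕ → Outcome N) : ℕ∞ :=
  ⨅ (n : ℕ) (_ : 1 ≤ n ∧ position ε x σI σII n ω ∉ D), (n : ℕ∞)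

/-- The finite (right circular) cone with vertex `0`, axis `v`, half-aperture `β`, height `h`. -/
def finiteCone {N : ℕ} (v : E N) (β h : ℝ) : Set (E N) :=
  {z | InnerProductGeometry.angle v z < β ∧ 0 < ‖z‖ ∧ ‖z‖ < h}

/-- The external cone condition with cone `C`: at each boundary point `x` of `D`, some rotation
`S ∈ SO(N)` satisfies `x + S C ⊆ ℝ^N \ D`. -/
def ExternalCone {N : ℕ} (D C : Set (E N)) : Prop :=
  ∀ x ∈ frontier D, ∃ S : E N ≃ₗᵢ[ℝ] E N,
    LinearMap.det (S.toLinearEquiv : E N →ₗ[ℝ] E N) = 1 ∧ ∀ z ∈ C, x + S z ∉ D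

/-! Well-posedness of the random data. -/

theorem apertureAngle_pos (N : ℕ) (p : ℝ) : 0 < apertureAngle N p := by
  unfold apertureAngle
  split_ifs with h
  · exact h.choose_spec.1.1
  · positivity

theorem norm_coordVec {N k : ℕ} (hk : k < N) : ‖coordVec N k‖ = 1 := by
  have h : coordVec N k = EuclideanSpace.single (⟨k, hk⟩ : Fin N) (1 : ℝ) := by
    ext i
    simp [coordVec, Fin.ext_iff]
  rw [h]; simp

theorem isOpen_truncCone (N : ℕ) (p : ℝ) (hN : 2 ≤ N) : IsOpen (truncCone N p) := by
  rw [isOpen_iff_mem_nhds]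
  rintro z ⟨h1, h2⟩
  have he : coordVec N 0 ≠ 0 := by
    rw [← norm_ne_zero_iff, norm_coordVec (by omega)]; exact one_ne_zero
  have hz : z ≠ 0 := by
    rw [← norm_pos_iff]; linarith
  have hc : ContinuousAt (fun w : E N => InnerProductGeometry.angle (coordVec N 0) w) z :=
    (InnerProductGeometry.continuousAt_angle (x := (coordVec N 0, z)) he hz).comp
      (f := fun w : E N => (coordVec N 0, w)) (by fun_prop)
  filter_upwards [hc.eventually (gt_mem_nhds h1),
    continuous_norm.continuousAt.eventually (lt_mem_nhds h2)] with w hw1 hw2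
  exact ⟨hw1, hw2⟩

theorem nonempty_truncCone (N : ℕ) (p : ℝ) (hN : 2 ≤ N) : (truncCone N p).Nonempty := by
  have h1 := norm_coordVec (N := N) (k := 0) (by omega)
  have he : coordVec N 0 ≠ 0 := by
    rw [← norm_ne_zero_iff, h1]; exact one_ne_zero
  refine ⟨(2 : ℝ) • coordVec N 0, ?_, ?_⟩
  · rw [InnerProductGeometry.angle_smul_right_of_pos _ _ two_pos,
      InnerProductGeometry.angle_self he]
    exact apertureAngle_pos N p
  · rw [norm_smul, h1]; norm_num

theorem fracConst_pos (N : ℕ) {s : ℝ} (hs : s ∈ Set.Ioo (1 / 2 : ℝ) 1) : 0 < fracConst N s := by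
  have h0 : 0 < s := by linarith [hs.1]
  have h1 := Real.Gamma_pos_of_pos (s := (N : ℝ) / 2 + s) (by positivity)
  have h2 := Real.Gamma_pos_of_pos (s := 1 - s) (by linarith [hs.2])
  have := Real.pi_pos
  unfold fracConst
  positivity

theorem fracMeasure_truncCone_ne_zero (N : ℕ) (p : ℝ) (hN : 2 ≤ N) {s : ℝ}
    (hs : s ∈ Set.Ioo (1 / 2 : ℝ) 1) : fracMeasure N s (truncCone N p) ≠ 0 := by
  have hO := isOpen_truncCone N p hN
  rw [fracMeasure, withDensity_apply _ hO.measurableSet, Ne,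
    lintegral_eq_zero_iff (by fun_prop), Filter.EventuallyEq,
    ae_restrict_iff' hO.measurableSet]
  intro h
  have hv : (volume : Measure (E N)) (truncCone N p) = 0 := by
    refine measure_mono_null (fun z hz => ?_) (ae_iff.1 h)
    have hz1 : 0 < ‖z‖ := lt_trans one_pos hz.2
    have : 0 < fracConst N s / ‖z‖ ^ ((N : ℝ) + 2 * s) :=
      div_pos (fracConst_pos N hs) (Real.rpow_pos_of_pos hz1 _)
    simp only [Set.mem_ofPred_eq, Pi.zero_apply, ENNReal.ofReal_eq_zero, not_forall]
    exact ⟨hz, not_le.2 this⟩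
  exact (hO.measure_pos volume (nonempty_truncCone N p hN)).ne' hv

theorem fracMeasure_truncCone_ne_top (N : ℕ) (p : ℝ) (hN : 2 ≤ N) {s : ℝ}
    (hs : s ∈ Set.Ioo (1 / 2 : ℝ) 1) : fracMeasure N s (truncCone N p) ≠ ⊤ := by
  have hO := isOpen_truncCone N p hN
  have h0 : 0 < s := by linarith [hs.1]
  rw [fracMeasure, withDensity_apply _ hO.measurableSet]
  set r : ℝ := (N : ℝ) + 2 * s with hr
  have hr0 : 0 < r := by positivity
  have hc := fracConst_pos N hs
  have hfin : (∫⁻ z : E N, ENNReal.ofReal ((1 + ‖z‖) ^ (-r))) < ⊤ :=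
    finite_integral_one_add_norm (by simp [hr]; exact h0)
  refine ne_top_of_le_ne_top
    (ENNReal.mul_ne_top (ENNReal.ofReal_ne_top (r := fracConst N s * 2 ^ r)) hfin.ne) ?_
  rw [← lintegral_const_mul _ (by fun_prop)]
  refine le_trans (setLIntegral_mono' hO.measurableSet (fun z hz => ?_))
    (setLIntegral_le_lintegral _ _)
  rw [← ENNReal.ofReal_mul (by positivity)]
  refine ENNReal.ofReal_le_ofReal ?_
  have hz1 : 1 < ‖z‖ := hz.2
  have hz0 : 0 < ‖z‖ := by linarith
  have key : (1 + ‖z‖) ^ r ≤ 2 ^ r * ‖z‖ ^ r := by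
    rw [← Real.mul_rpow (by norm_num) hz0.le]
    exact Real.rpow_le_rpow (by positivity) (by linarith) hr0.le
  rw [Real.rpow_neg (by positivity), mul_assoc, div_eq_mul_inv]
  refine mul_le_mul_of_nonneg_left ?_ hc.le
  rw [← div_eq_mul_inv, inv_eq_one_div, div_le_div_iff₀ (by positivity) (by positivity), one_mul]
  exact key

theorem isProbabilityMeasure_stepLaw (N : ℕ) (p : ℝ) (hN : 2 ≤ N) {s : ℝ}
    (hs : s ∈ Set.Ioo (1 / 2 : ℝ) 1) : IsProbabilityMeasure (stepLaw N p s) := by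
  have h1 : IsProbabilityMeasure ((fracMeasure N s)[|truncCone N p]) :=
    cond_isProbabilityMeasure_of_finite (fracMeasure_truncCone_ne_zero N p hN hs)
      (fracMeasure_truncCone_ne_top N p hN hs)
  have h2 : IsProbabilityMeasure (uniformOn (Set.univ : Set Bool)) :=
    isProbabilityMeasure_uniformOn Set.finite_univ Set.univ_nonempty
  unfold stepLaw
  infer_instance

theorem isProbabilityMeasure_gameLaw (N : ℕ) (p : ℝ) (hN : 2 ≤ N) {s : ℝ}
    (hs : s ∈ Set.Ioo (1 / 2 : ℝ) 1) : IsProbabilityMeasure (gameLaw N p s) := by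
  have := isProbabilityMeasure_stepLaw N p hN hs
  unfold gameLaw
  infer_instance

end FracTug

namespace FracTug

/-! The exterior cone at `x` contains a ball of radius `κ r` about a point `z₀` at distance `r` from
`x`, where `r` is comparable to `min δ h` and `κ` depends only on the cone. Player I always aims at
`z₀`.

The key is that a truncated power of the distance, `max(|X - z₀|, c)^{-2k}` with `c = κ r / 2`, is a
submartingale while the game stays outside that ball, provided `k` is large (`barrier_step`). At
distance `ρ` from `z₀`, put `M = ρ / (2ε)` and compare three effects. The mean of the jumps with
`|z| ≤ M` is a nonnegative multiple of `e₁`, so the first-order term gained by Player I is at least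
what Player II can take away. Second-order terms and jumps with `|z| > M` cost at most a multiple of
`(1 + k) M^{-2s}`. With probability at least a multiple of `M^{-2s}`, Player I makes a jump of
length between `ρ/4` and `ρ/2` nearly straight at `z₀`, which multiplies the power by at least
`(16/11)^k`. All errors have the same order in `M`, so one `k` works at every scale, since
exponential growth beats linear growth.

An affine decreasing function of the barrier is then a nonnegative supermartingale that is at least
1 on `D` outside `B_δ(x)`. The maximal inequality `measure_enter_le` bounds the exit probability by
its value at `x₀`, which is below 1 by an amount depending only on `κ` and `k` (`measure_leave_le`).
-/

/-! ### Rotations, and measurability of the game. -/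

theorem reflection_orthogonal_span_singleton_apply {N : ℕ} (u x : E N) :
    (Submodule.span ℝ {u})ᗮ.reflection x = x - (2 * (inner ℝ u x / ‖u‖ ^ 2)) • u := by
  rw [Submodule.reflection_orthogonal_apply, Submodule.reflection_singleton_apply]
  simp only [RCLike.ofReal_real_eq_id, id_eq, neg_sub, mul_smul, two_smul]

open Classical in
theorem measurable_rot {N : ℕ} {α : Type*} [MeasurableSpace α] {f g : α → E N}
    (hf : Measurable f) (hg : Measurable g) : Measurable (fun q => rot (f q) (g q)) := by
  have hw : Measurable (fun q =>
      if f q = -coordVec N 0 then coordVec N 1 else coordVec N 0 + f q) :=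
    Measurable.ite (hf (measurableSet_singleton (-coordVec N 0)))
      measurable_const (by fun_prop)
  have hr : Measurable (fun q =>
      g q - (2 * (inner ℝ (coordVec N 0) (g q) / ‖coordVec N 0‖ ^ 2)) • coordVec N 0) := by
    fun_prop
  have h : (fun q => rot (f q) (g q)) = fun q =>
      (g q - (2 * (inner ℝ (coordVec N 0) (g q) / ‖coordVec N 0‖ ^ 2)) • coordVec N 0) -
        (2 * (inner ℝ (if f q = -coordVec N 0 then coordVec N 1 else coordVec N 0 + f q)
          (g q - (2 * (inner ℝ (coordVec N 0) (g q) / ‖coordVec N 0‖ ^ 2)) • coordVec N 0) /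
          ‖(if f q = -coordVec N 0 then coordVec N 1 else coordVec N 0 + f q)‖ ^ 2)) •
        (if f q = -coordVec N 0 then coordVec N 1 else coordVec N 0 + f q) := by
    funext q
    simp only [rot, LinearIsometryEquiv.trans_apply, reflection_orthogonal_span_singleton_apply]
  rw [h]
  exact hr.sub ((((hw.inner hr).div (hw.norm.pow_const 2)).const_mul 2).smul hw)

theorem inner_coordVec_zero_one (N : ℕ) : inner ℝ (coordVec N 1) (coordVec N 0) = 0 := by
  simp only [coordVec, PiLp.inner_apply]
  refine Finset.sum_eq_zero fun i _ => ?_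
  by_cases h : i.val = 0 <;> simp [h]

/-- The first reflection sends `e₁` to `-e₁`. The second one exchanges the unit vectors `e₁` and
`-y`, because `e₁ + y` is their difference; in the exceptional case `y = -e₁` it fixes `-e₁`, which
is orthogonal to `e₂`. -/
theorem rot_coordVec_zero {N : ℕ} (hN : 2 ≤ N) {y : E N} (hy : ‖y‖ = 1) :
    rot y (coordVec N 0) = y := by
  have he : ‖coordVec N 0‖ = 1 := norm_coordVec (by omega)
  rw [rot, LinearIsometryEquiv.trans_apply,
    Submodule.reflection_orthogonalComplement_singleton_eq_neg, map_neg]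
  split_ifs with h
  · rw [reflection_orthogonal_span_singleton_apply, inner_coordVec_zero_one, h]
    simp
  · have := Submodule.reflection_sub (v := coordVec N 0) (w := -y) (by rw [norm_neg, he, hy])
    rw [sub_neg_eq_add] at this
    rw [this, neg_neg]

theorem History.measurable_pos {N : ℕ} : ∀ n : ℕ, Measurable (History.pos : History N n → E N)
  | 0 => measurable_fst
  | n + 1 => by
    show Measurable (fun H : History N (n + 1) => (H.2 (Fin.last n)).1)
    fun_prop

/-- The direction applied in the round that follows a history `H`, for the outcome `b`. -/
noncomputable def moveDir {N : ℕ} (σI σII : Strategy N) {n : ℕ} (H : History N n) (b : Bool) :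
    E N :=
  ((if b = true then σI.dir n H else σII.dir n H : Metric.sphere (0 : E N) 1) : E N)

theorem measurable_moveDir {N : ℕ} (σI σII : Strategy N) (n : ℕ) :
    Measurable (fun q : History N n × Bool => moveDir σI σII q.1 q.2) := by
  refine measurable_subtype_coe.comp (Measurable.ite ?_ ?_ ?_)
  · exact measurable_snd (measurableSet_singleton true)
  · exact (σI.measurable_dir n).comp measurable_fst
  · exact (σII.measurable_dir n).comp measurable_fst

theorem measurable_move {N : ℕ} (ε : ℝ) (σI σII : Strategy N) (n : ℕ) :
    Measurable (fun q : History N n × Outcome N =>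
      q.1.pos + ε • rot (moveDir σI σII q.1 q.2.2) q.2.1) := by
  have h0 : Measurable (fun q : History N n × Outcome N => q.1.pos) :=
    (History.measurable_pos n).comp measurable_fst
  have hb : Measurable (fun q : History N n × Outcome N => (q.1, q.2.2)) :=
    measurable_fst.prodMk (measurable_snd.comp measurable_snd)
  have h1 : Measurable (fun q : History N n × Outcome N => moveDir σI σII q.1 q.2.2) :=
    (measurable_moveDir σI σII n).comp hb
  have h2 : Measurable (fun q : History N n × Outcome N =>
      rot (moveDir σI σII q.1 q.2.2) q.2.1) :=
    measurable_rot h1 (measurable_fst.comp measurable_snd)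
  exact h0.add (h2.const_smul ε)

theorem history_succ {N : ℕ} (ε : ℝ) (x : E N) (σI σII : Strategy N) (ω : ℕ → Outcome N)
    (n : ℕ) : history ε x σI σII ω (n + 1) =
      (x, Fin.snoc (history ε x σI σII ω n).2
        ((history ε x σI σII ω n).pos +
          ε • rot (moveDir σI σII (history ε x σI σII ω n) (ω n).2) (ω n).1, ω n)) := rfl

theorem position_succ {N : ℕ} (ε : ℝ) (x : E N) (σI σII : Strategy N) (n : ℕ)
    (ω : ℕ → Outcome N) : position ε x σI σII (n + 1) ω =
      position ε x σI σII n ω +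
        ε • rot (moveDir σI σII (history ε x σI σII ω n) (ω n).2) (ω n).1 := by
  simp only [position, history_succ, History.pos, Fin.snoc_last]

theorem measurable_history {N : ℕ} (ε : ℝ) (x : E N) (σI σII : Strategy N) :
    ∀ n : ℕ, Measurable (fun ω : ℕ → Outcome N => history ε x σI σII ω n)
  | 0 => measurable_const
  | n + 1 => by
    have ih := measurable_history ε x σI σII n
    simp only [history_succ]
    refine measurable_const.prodMk (measurable_pi_iff.2 fun i => ?_)
    refine Fin.lastCases ?_ (fun j => ?_) i
    · simp only [Fin.snoc_last]
      exact ((measurable_move ε σI σII n).comp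
        (ih.prodMk (measurable_pi_apply n))).prodMk (measurable_pi_apply n)
    · simp only [Fin.snoc_castSucc]
      exact (measurable_pi_apply j).comp (measurable_snd.comp ih)

theorem measurable_position {N : ℕ} (ε : ℝ) (x : E N) (σI σII : Strategy N) (n : ℕ) :
    Measurable (position ε x σI σII n) :=
  (History.measurable_pos n).comp (measurable_history ε x σI σII n)

/-- The game does not anticipate: this is what makes the outcome of the next round independent of
the history. -/
theorem history_congr {N : ℕ} (ε : ℝ) (x : E N) (σI σII : Strategy N) {ω ω' : ℕ → Outcome N} :
    ∀ {n : ℕ}, (∀ i < n, ω i = ω' i) → history ε x σI σII ω n = history ε x σI σII ω' n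
  | 0, _ => rfl
  | n + 1, h => by
    rw [history_succ, history_succ, history_congr ε x σI σII (fun i hi => h i (by omega)),
      h n (by omega)]

/-! ### The supermartingale inequality for the game. -/

/-- Integrating out the `n`-th coordinate of a function that otherwise depends only on the
coordinates before `n`. -/
theorem lintegral_infinitePi_step {O : Type*} [MeasurableSpace O] (P : Measure O)
    [IsProbabilityMeasure P] (n : ℕ) {F : (ℕ → O) → O → ENNReal}
    (hF : Measurable (Function.uncurry F))
    (hdep : ∀ ω ω' o, (∀ i < n, ω i = ω' i) → F ω o = F ω' o) :
    ∫⁻ ω, F ω (ω n) ∂(Measure.infinitePi fun _ : ℕ => P) =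
      ∫⁻ ω, ∫⁻ o, F ω o ∂P ∂(Measure.infinitePi fun _ : ℕ => P) := by
  obtain ⟨o₀⟩ : Nonempty O := P.nonempty_of_neZero
  set μ := Measure.infinitePi fun _ : ℕ => P
  -- Coordinates from `n` on are overwritten by the constant `o₀`. This does not change `F`, and
  -- makes its first argument a function of the coordinates before `n`, hence independent of `ω n`.
  let g : (Finset.range n → O) → (ℕ → O) := fun r i =>
    if h : i ∈ Finset.range n then r ⟨i, h⟩ else o₀
  have hg : Measurable g := by
    refine measurable_pi_iff.2 fun i => ?_
    by_cases h : i ∈ Finset.range n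
    · simp only [g, h, dite_true]; fun_prop
    · simp only [g, h, dite_false]; fun_prop
  let X : (ℕ → O) → (ℕ → O) := fun ω => g fun i => ω i
  have hX : Measurable X := hg.comp (g := g) (f := fun (ω : ℕ → O) (i : Finset.range n) => ω i)
    (measurable_pi_iff.2 fun i => measurable_pi_apply (i : ℕ))
  have hXn : ∀ ω, ∀ i < n, ω i = X ω i := fun ω i hi => by simp [X, g, hi]
  have hind : IndepFun X (fun ω => ω n) μ := by
    have h1 : iIndepFun (fun i (ω : ℕ → O) => ω i) μ :=
      iIndepFun_infinitePi (X := fun _ o => o) (fun _ => measurable_id)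
    have h2 := h1.indepFun_finset (Finset.range n) {n} (by simp) (fun i => measurable_pi_apply i)
    have h3 : Measurable (fun r : ({n} : Finset ℕ) → O => r ⟨n, by simp⟩) :=
      measurable_pi_apply _
    exact h2.comp hg h3
  have hmap := (indepFun_iff_map_prod_eq_prod_map_map hX.aemeasurable
    (measurable_pi_apply n).aemeasurable).1 hind
  have heval : μ.map (fun ω => ω n) = P := Measure.infinitePi_map_eval (μ := fun _ : ℕ => P) n
  rw [heval] at hmap
  calc ∫⁻ ω, F ω (ω n) ∂μ
      = ∫⁻ ω, Function.uncurry F (X ω, ω n) ∂μ :=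
        lintegral_congr fun ω => hdep _ _ _ (hXn ω)
    _ = ∫⁻ q, Function.uncurry F q ∂((μ.map X).prod P) := by
        rw [← hmap, lintegral_map hF (hX.prodMk (measurable_pi_apply n))]
    _ = ∫⁻ ω, ∫⁻ o, F ω o ∂P ∂(μ.map X) := lintegral_prod _ hF.aemeasurable
    _ = ∫⁻ ω, ∫⁻ o, F (X ω) o ∂P ∂μ :=
        lintegral_map hF.lintegral_prod_right' hX
    _ = _ := lintegral_congr fun ω => lintegral_congr fun o => (hdep _ _ _ (hXn ω)).symm

/-- The law of the vector `z` in one round. -/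
noncomputable def jumpLaw (N : ℕ) (p s : ℝ) : Measure (E N) := (fracMeasure N s)[|truncCone N p]

theorem isProbabilityMeasure_jumpLaw (N : ℕ) (p : ℝ) (hN : 2 ≤ N) {s : ℝ}
    (hs : s ∈ Set.Ioo (1 / 2 : ℝ) 1) : IsProbabilityMeasure (jumpLaw N p s) :=
  cond_isProbabilityMeasure_of_finite (fracMeasure_truncCone_ne_zero N p hN hs)
    (fracMeasure_truncCone_ne_top N p hN hs)

theorem lintegral_stepLaw (N : ℕ) (p : ℝ) (hN : 2 ≤ N) {s : ℝ} (hs : s ∈ Set.Ioo (1 / 2 : ℝ) 1)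
    {f : Outcome N → ENNReal} (hf : Measurable f) :
    ∫⁻ o, f o ∂(stepLaw N p s) =
      ((∫⁻ z, f (z, true) ∂(jumpLaw N p s)) + ∫⁻ z, f (z, false) ∂(jumpLaw N p s)) / 2 := by
  have := isProbabilityMeasure_jumpLaw N p hN hs
  have h2 : IsProbabilityMeasure (uniformOn (Set.univ : Set Bool)) :=
    isProbabilityMeasure_uniformOn Set.finite_univ Set.univ_nonempty
  rw [stepLaw, ← jumpLaw, lintegral_prod_symm _ hf.aemeasurable, lintegral_fintype]
  simp only [Fintype.sum_bool, uniformOn_univ, Measure.count_singleton, Fintype.card_bool]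
  rw [← add_mul, div_eq_mul_inv]
  simp [div_eq_mul_inv]

/-- Maximal inequality: while the position is in `G`, `v` is a supermartingale if Player I follows
the direction field `a`; so the game enters `K` directly from `G` with probability at most the
initial value of `v`, if `v ≥ 1` on `K`. -/
theorem measure_enter_le {N : ℕ} (hN : 2 ≤ N) (p : ℝ) {s : ℝ} (hs : s ∈ Set.Ioo (1 / 2 : ℝ) 1)
    (ε : ℝ) {G K : Set (E N)} (hG : MeasurableSet G) (hK : MeasurableSet K) (hGK : Disjoint G K)
    {v : E N → ENNReal} (hv : Measurable v) (hvK : ∀ x ∈ K, 1 ≤ v x)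
    (a : E N → Metric.sphere (0 : E N) 1)
    (hstep : ∀ x ∈ G, ∀ y : E N, ‖y‖ = 1 →
      (∫⁻ z, v (x + ε • rot (a x : E N) z) ∂(jumpLaw N p s)) +
        ∫⁻ z, v (x + ε • rot y z) ∂(jumpLaw N p s) ≤ 2 * v x)
    (x₀ : E N) (σI σII : Strategy N) (hσ : ∀ n H, σI.dir n H = a H.pos) :
    gameLaw N p s {ω | ∃ n, (∀ k < n, position ε x₀ σI σII k ω ∈ G) ∧
      position ε x₀ σI σII n ω ∈ K} ≤ v x₀ := by
  have hprob := isProbabilityMeasure_stepLaw N p hN hs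
  have hprob' := isProbabilityMeasure_gameLaw N p hN hs
  set μ := gameLaw N p s with hμ
  set X := position ε x₀ σI σII with hX
  have hXm : ∀ n, Measurable (X n) := measurable_position ε x₀ σI σII
  let A : ℕ → Set (ℕ → Outcome N) := fun n => {ω | ∀ k < n, X k ω ∈ G}
  have hA : ∀ n, MeasurableSet (A n) := fun n => by
    have : A n = ⋂ k, ⋂ _ : k < n, X k ⁻¹' G := by ext; simp [A]
    rw [this]
    exact MeasurableSet.iInter fun k => MeasurableSet.iInter fun _ => hXm k hG
  -- Mass of `v` on the paths that were in `G` at all times before `n`. It replaces the stopped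
  -- process, so that no conditional expectations are needed.
  let m : ℕ → ENNReal := fun n => ∫⁻ ω, (A n).indicator (fun ω => v (X n ω)) ω ∂μ
  have hone : ∀ n, m (n + 1) ≤ ∫⁻ ω, (A (n + 1)).indicator (fun ω => v (X n ω)) ω ∂μ := by
    intro n
    let F : (ℕ → Outcome N) → Outcome N → ENNReal := fun ω o =>
      (A (n + 1)).indicator (fun ω => v (X n ω +
        ε • rot (moveDir σI σII (history ε x₀ σI σII ω n) o.2) o.1)) ω
    have hmove : Measurable (fun q : (ℕ → Outcome N) × Outcome N => v (X n q.1 +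
        ε • rot (moveDir σI σII (history ε x₀ σI σII q.1 n) q.2.2) q.2.1)) :=
      hv.comp ((measurable_move ε σI σII n).comp
        (((measurable_history ε x₀ σI σII n).comp measurable_fst).prodMk measurable_snd))
    have hF : Measurable (Function.uncurry F) :=
      hmove.indicator (measurable_fst (hA (n + 1)))
    have hdep : ∀ ω ω' o, (∀ i < n, ω i = ω' i) → F ω o = F ω' o := by
      intro ω ω' o h
      have hh : ∀ k ≤ n, history ε x₀ σI σII ω k = history ε x₀ σI σII ω' k := fun k hk =>
        history_congr ε x₀ σI σII fun i hi => h i (by omega)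
      have hp : ∀ k ≤ n, X k ω = X k ω' := fun k hk => by
        simp only [hX, position, hh k hk]
      have hmem : ω ∈ A (n + 1) ↔ ω' ∈ A (n + 1) := by
        refine forall_congr' fun k => imp_congr_right fun hk => ?_
        rw [hp k (by omega)]
      by_cases hω : ω ∈ A (n + 1)
      · simp only [F, Set.indicator_of_mem hω, Set.indicator_of_mem (hmem.1 hω), hp n le_rfl,
          hh n le_rfl]
      · simp only [F, Set.indicator_of_notMem hω, Set.indicator_of_notMem (mt hmem.2 hω)]
    have key := lintegral_infinitePi_step (stepLaw N p s) n hF hdep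
    calc m (n + 1) = ∫⁻ ω, F ω (ω n) ∂μ := by
          refine lintegral_congr fun ω => ?_
          simp only [F, Set.indicator, hX, position_succ]
      _ = ∫⁻ ω, ∫⁻ o, F ω o ∂(stepLaw N p s) ∂μ := key
      _ ≤ _ := by
          refine lintegral_mono fun ω => ?_
          by_cases hω : ω ∈ A (n + 1)
          · simp only [F, Set.indicator_of_mem hω]
            have hm2 : Measurable (fun o : Outcome N => v (X n ω +
                ε • rot (moveDir σI σII (history ε x₀ σI σII ω n) o.2) o.1)) :=
              hmove.comp (measurable_const.prodMk measurable_id)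
            rw [lintegral_stepLaw N p hN hs hm2]
            refine ENNReal.div_le_of_le_mul' ?_
            have := hstep (X n ω) (hω n (by omega))
              (σII.dir n (history ε x₀ σI σII ω n)) (by simp)
            simp only [moveDir, hσ]
            exact this
          · simp [F, Set.indicator_of_notMem hω]
  -- Paths in `K` at time `n` pay at least their probability, as `v ≥ 1` there, and leave the
  -- account; paths outside `G ∪ K` are dropped, as `v ≥ 0`. Summing over `n` telescopes.
  have htwo : ∀ n, m (n + 1) + μ (A n ∩ X n ⁻¹' K) ≤ m n := by
    intro n
    have hE : MeasurableSet (A n ∩ X n ⁻¹' K) := (hA n).inter (hXm n hK)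
    refine (add_le_add_left (hone n) _).trans ?_
    rw [← lintegral_indicator_one hE, ← lintegral_add_right _ (measurable_one.indicator hE)]
    refine lintegral_mono fun ω => ?_
    by_cases hω : ω ∈ A n
    · by_cases hxG : X n ω ∈ G
      · have h1 : ω ∉ A n ∩ X n ⁻¹' K := fun h => Set.disjoint_left.1 hGK hxG h.2
        have h2 : ω ∈ A (n + 1) := fun k hk => by
          rcases Nat.lt_succ_iff_lt_or_eq.1 hk with h | rfl
          exacts [hω k h, hxG]
        simp [Set.indicator_of_mem hω, Set.indicator_of_mem h2, Set.indicator_of_notMem h1]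
      · have h2 : ω ∉ A (n + 1) := fun h => hxG (h n (by omega))
        by_cases hxK : X n ω ∈ K
        · have h1 : ω ∈ A n ∩ X n ⁻¹' K := ⟨hω, hxK⟩
          simpa [Set.indicator_of_mem hω, Set.indicator_of_mem h1, Set.indicator_of_notMem h2]
            using hvK _ hxK
        · have h1 : ω ∉ A n ∩ X n ⁻¹' K := fun h => hxK h.2
          simp [Set.indicator_of_notMem h1, Set.indicator_of_notMem h2]
    · have h1 : ω ∉ A n ∩ X n ⁻¹' K := fun h => hω h.1
      have h2 : ω ∉ A (n + 1) := fun h => hω fun k hk => h k (by omega)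
      simp [Set.indicator_of_notMem h1, Set.indicator_of_notMem h2]
  have hsum : ∀ n, m n + ∑ k ∈ Finset.range n, μ (A k ∩ X k ⁻¹' K) ≤ v x₀ := by
    intro n
    induction n with
    | zero =>
      have h0 : ∀ ω, X 0 ω = x₀ := fun _ => rfl
      have hA0 : A 0 = Set.univ := by ext; simp [A]
      simp [m, h0, hA0]
    | succ n ih =>
      rw [Finset.sum_range_succ, add_comm (Finset.sum _ _), ← add_assoc]
      exact (add_le_add_left (htwo n) _).trans ih
  have hset : {ω | ∃ n, (∀ k < n, X k ω ∈ G) ∧ X n ω ∈ K} = ⋃ n, A n ∩ X n ⁻¹' K := by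
    ext ω; simp [A]
  rw [hset]
  refine (measure_iUnion_le _).trans ?_
  rw [ENNReal.tsum_eq_iSup_nat]
  exact iSup_le fun n => le_add_self.trans (hsum n)

/-! ### Scaling, moments and symmetry of the law of a jump. -/

theorem apertureAngle_le (N : ℕ) (p : ℝ) : apertureAngle N p ≤ Real.pi / 2 := by
  unfold apertureAngle
  split_ifs with h
  · exact h.choose_spec.1.2
  · exact le_rfl

theorem inner_pos_of_mem_truncCone {N : ℕ} (hN : 2 ≤ N) {p : ℝ} {z : E N}
    (hz : z ∈ truncCone N p) : 0 < inner ℝ (coordVec N 0) z := by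
  have h1 := norm_coordVec (N := N) (k := 0) (by omega)
  have hz0 : 0 < ‖z‖ := zero_lt_one.trans hz.2
  have hcos : 0 < Real.cos (InnerProductGeometry.angle (coordVec N 0) z) := by
    refine Real.cos_pos_of_mem_Ioo ⟨?_, hz.1.trans_le (apertureAngle_le N p)⟩
    linarith [InnerProductGeometry.angle_nonneg (coordVec N 0) z, Real.pi_pos]
  rw [← InnerProductGeometry.cos_angle_mul_norm_mul_norm, h1]
  positivity

/-- The density is homogeneous of degree `-N - 2s`, which gives `t ^ (N + 2s)`; the change of
variables contributes `t ^ (-N)`. -/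
theorem fracMeasure_smul_preimage (N : ℕ) (s : ℝ) {t : ℝ} (ht : 0 < t) {A : Set (E N)}
    (hA : MeasurableSet A) :
    fracMeasure N s ((fun z => t • z) ⁻¹' A) = ENNReal.ofReal (t ^ (2 * s)) * fracMeasure N s A := by
  have hm : Measurable (fun z : E N => t • z) := measurable_const_smul t
  set r : ℝ := (N : ℝ) + 2 * s with hr
  have hφ : Measurable (fun z : E N => ENNReal.ofReal (fracConst N s / ‖z‖ ^ r)) := by fun_prop
  rw [fracMeasure, withDensity_apply _ (hm hA), withDensity_apply _ hA]
  have h1 := setLIntegral_map (μ := (volume : Measure (E N))) hA hφ hm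
  rw [Measure.map_addHaar_smul _ ht.ne', Measure.restrict_smul, lintegral_smul_measure] at h1
  have h2 : ∀ z : E N, ENNReal.ofReal (fracConst N s / ‖z‖ ^ r) =
      ENNReal.ofReal (t ^ r) * ENNReal.ofReal (fracConst N s / ‖t • z‖ ^ r) := by
    intro z
    rw [← ENNReal.ofReal_mul (by positivity), norm_smul, Real.norm_of_nonneg ht.le,
      Real.mul_rpow ht.le (norm_nonneg z)]
    congr 1
    have : t ^ r ≠ 0 := (Real.rpow_pos_of_pos ht r).ne'
    rw [← div_div, mul_comm, div_right_comm, div_mul_cancel₀ _ this]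
  calc ∫⁻ z in (fun z => t • z) ⁻¹' A, ENNReal.ofReal (fracConst N s / ‖z‖ ^ r)
      = ENNReal.ofReal (t ^ r) *
        ∫⁻ z in (fun z => t • z) ⁻¹' A, ENNReal.ofReal (fracConst N s / ‖t • z‖ ^ r) := by
        have hφm : Measurable (fun z : E N => ENNReal.ofReal (fracConst N s / ‖t • z‖ ^ r)) :=
          hφ.comp hm
        rw [← lintegral_const_mul _ hφm]
        exact lintegral_congr fun z => h2 z
    _ = _ := by
        rw [← h1, smul_eq_mul, ← mul_assoc, ← ENNReal.ofReal_mul (by positivity),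
          finrank_euclideanSpace_fin, abs_of_pos (by positivity), ← Real.rpow_natCast,
          ← div_eq_mul_inv, ← Real.rpow_sub ht]
        congr 3
        rw [hr]; ring

theorem fracMeasure_pos_of_isOpen (N : ℕ) {s : ℝ} (hs : s ∈ Set.Ioo (1 / 2 : ℝ) 1)
    {U : Set (E N)} (hU : IsOpen U) (hne : U.Nonempty) (h0 : (0 : E N) ∉ U) :
    fracMeasure N s U ≠ 0 := by
  rw [fracMeasure, withDensity_apply _ hU.measurableSet, Ne,
    lintegral_eq_zero_iff (by fun_prop), Filter.EventuallyEq,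
    ae_restrict_iff' hU.measurableSet]
  intro h
  have hv : (volume : Measure (E N)) U = 0 := by
    refine measure_mono_null (fun z hz => ?_) (ae_iff.1 h)
    have hz1 : 0 < ‖z‖ := norm_pos_iff.2 fun h => h0 (h ▸ hz)
    have : 0 < fracConst N s / ‖z‖ ^ ((N : ℝ) + 2 * s) :=
      div_pos (fracConst_pos N hs) (Real.rpow_pos_of_pos hz1 _)
    simp only [Set.mem_ofPred_eq, Pi.zero_apply, ENNReal.ofReal_eq_zero, not_forall]
    exact ⟨hz, not_le.2 this⟩
  exact (hU.measure_pos volume hne).ne' hv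

theorem smul_mem_truncCone_iff {N : ℕ} {p t : ℝ} (ht : 0 < t) {z : E N} :
    t • z ∈ truncCone N p ↔
      InnerProductGeometry.angle (coordVec N 0) z < apertureAngle N p ∧ 1 < t * ‖z‖ := by
  rw [truncCone, Set.mem_ofPred_eq, InnerProductGeometry.angle_smul_right_of_pos _ _ ht, norm_smul,
    Real.norm_of_nonneg ht.le]

/-- Scaling of the law of the jumps, for subsets of the cone. -/
theorem jumpLaw_scale (N : ℕ) (p : ℝ) (hN : 2 ≤ N) (s : ℝ) {M : ℝ} (hM : 1 ≤ M)
    {A B : Set (E N)} (hA : MeasurableSet A)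
    (h : ∀ z, (z ∈ truncCone N p ∧ z ∈ B) ↔ (M⁻¹ • z ∈ truncCone N p ∧ M⁻¹ • z ∈ A)) :
    jumpLaw N p s B = ENNReal.ofReal (M ^ (-(2 * s))) * jumpLaw N p s A := by
  have hT := (isOpen_truncCone N p hN).measurableSet
  have hM0 : 0 < M := by linarith
  rw [jumpLaw, cond_apply hT, cond_apply hT]
  have : truncCone N p ∩ B = (fun z => M⁻¹ • z) ⁻¹' (truncCone N p ∩ A) := by
    ext z; exact h z
  rw [this, fracMeasure_smul_preimage N s (inv_pos.2 hM0) (hT.inter hA), Real.inv_rpow hM0.le,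
    ← Real.rpow_neg hM0.le]
  ring

theorem jumpLaw_tail (N : ℕ) (p : ℝ) (hN : 2 ≤ N) {s : ℝ} (hs : s ∈ Set.Ioo (1 / 2 : ℝ) 1)
    {M : ℝ} (hM : 0 < M) :
    jumpLaw N p s {z | M < ‖z‖} ≤ ENNReal.ofReal (M ^ (-(2 * s))) := by
  have hP := isProbabilityMeasure_jumpLaw N p hN hs
  have hs0 : 0 < s := by linarith [hs.1]
  rcases le_total 1 M with h1 | h1
  · rw [jumpLaw_scale N p hN s h1 (A := Set.univ) MeasurableSet.univ, measure_univ, mul_one]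
    intro z
    rw [smul_mem_truncCone_iff (inv_pos.2 hM), inv_mul_eq_div, one_lt_div hM, truncCone]
    simp only [Set.mem_ofPred_eq, Set.mem_univ, and_true]
    constructor
    · rintro ⟨⟨h, _⟩, h'⟩; exact ⟨h, h'⟩
    · rintro ⟨h, h'⟩; exact ⟨⟨h, h1.trans_lt h'⟩, h'⟩
  · refine prob_le_one.trans ?_
    rw [← ENNReal.ofReal_one]
    refine ENNReal.ofReal_le_ofReal ?_
    rw [Real.rpow_neg hM.le]
    exact (one_le_inv₀ (by positivity)).2 (Real.rpow_le_one hM.le h1 (by positivity))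

/-- The vectors of length in `(M/2, M)` that are close to the direction of `e₁`. -/
def nearAxis (N : ℕ) (M : ℝ) : Set (E N) :=
  {z | M / 2 < ‖z‖ ∧ ‖z‖ < M ∧ 3 / 4 * ‖z‖ < inner ℝ (coordVec N 0) z}

theorem isOpen_nearAxis (N : ℕ) (M : ℝ) : IsOpen (nearAxis N M) := by
  have h1 : IsOpen {z : E N | M / 2 < ‖z‖} := isOpen_lt (by fun_prop) (by fun_prop)
  have h2 : IsOpen {z : E N | ‖z‖ < M} := isOpen_lt (by fun_prop) (by fun_prop)
  have h3 : IsOpen {z : E N | 3 / 4 * ‖z‖ < inner ℝ (coordVec N 0) z} :=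
    isOpen_lt (by fun_prop) (by fun_prop)
  exact h1.inter (h2.inter h3)

/-- Favourable jumps at scale `M` have the same power of `M` as the tail `{M < ‖z‖}`, so they can
pay for it. -/
theorem jumpLaw_nearAxis (N : ℕ) (p : ℝ) (hN : 2 ≤ N) (s : ℝ) {M : ℝ} (hM : 2 ≤ M) :
    jumpLaw N p s (nearAxis N M) =
      ENNReal.ofReal ((M / 2) ^ (-(2 * s))) * jumpLaw N p s (nearAxis N 2) := by
  have hM0 : 0 < M / 2 := by linarith
  refine jumpLaw_scale N p hN s (by linarith) (isOpen_nearAxis N 2).measurableSet fun z => ?_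
  rw [smul_mem_truncCone_iff (inv_pos.2 hM0), inv_mul_eq_div, one_lt_div hM0, truncCone]
  simp only [nearAxis, Set.mem_ofPred_eq, norm_smul, Real.norm_of_nonneg (inv_pos.2 hM0).le,
    inner_smul_right]
  have h1 : (2 : ℝ) / 2 < (M / 2)⁻¹ * ‖z‖ ↔ M / 2 < ‖z‖ := by
    rw [div_self two_ne_zero, inv_mul_eq_div, one_lt_div hM0]
  have h2 : (M / 2)⁻¹ * ‖z‖ < 2 ↔ ‖z‖ < M := by
    rw [inv_mul_eq_div, div_lt_iff₀ hM0]; ring_nf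
  have h3 : 3 / 4 * ((M / 2)⁻¹ * ‖z‖) < (M / 2)⁻¹ * inner ℝ (coordVec N 0) z ↔
      3 / 4 * ‖z‖ < inner ℝ (coordVec N 0) z := by
    rw [mul_left_comm]; exact mul_lt_mul_iff_right₀ (inv_pos.2 hM0)
  rw [h1, h2, h3]
  constructor
  · rintro ⟨⟨h, _⟩, h'⟩; exact ⟨⟨h, h'.1⟩, h'⟩
  · rintro ⟨⟨h, _⟩, h'⟩; exact ⟨⟨h, by linarith [h'.1]⟩, h'⟩

theorem jumpLaw_nearAxis_pos (N : ℕ) (p : ℝ) (hN : 2 ≤ N) {s : ℝ}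
    (hs : s ∈ Set.Ioo (1 / 2 : ℝ) 1) : jumpLaw N p s (nearAxis N 2) ≠ 0 := by
  have hO := isOpen_truncCone N p hN
  have h1 := norm_coordVec (N := N) (k := 0) (by omega)
  have he : coordVec N 0 ≠ 0 := by
    rw [← norm_ne_zero_iff, h1]; exact one_ne_zero
  rw [jumpLaw, cond_apply hO.measurableSet]
  refine mul_ne_zero (ENNReal.inv_ne_zero.2 (fracMeasure_truncCone_ne_top N p hN hs)) ?_
  refine fracMeasure_pos_of_isOpen N hs (hO.inter (isOpen_nearAxis N 2))
    ⟨(3 / 2 : ℝ) • coordVec N 0, ⟨?_, ?_⟩, ?_⟩ ?_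
  · rw [InnerProductGeometry.angle_smul_right_of_pos _ _ (by norm_num),
      InnerProductGeometry.angle_self he]
    exact apertureAngle_pos N p
  · rw [norm_smul, h1]; norm_num
  · simp only [nearAxis, Set.mem_ofPred_eq, norm_smul, h1, inner_smul_right,
      real_inner_self_eq_norm_sq]
    norm_num
  · rintro ⟨⟨_, h⟩, _⟩
    simp at h
    linarith

/-- Layer-cake formula: the integral is `2 ∫₀^M t P(|z| > t) dt`, and the tail is at most `t ^
(-2s)`. Convergence at `0` uses `s < 1`. -/
theorem integral_min_norm_sq_le (N : ℕ) (p : ℝ) (hN : 2 ≤ N) {s : ℝ}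
    (hs : s ∈ Set.Ioo (1 / 2 : ℝ) 1) {M : ℝ} (hM : 0 < M) :
    ∫ z, (min ‖z‖ M) ^ 2 ∂(jumpLaw N p s) ≤ M ^ (2 - 2 * s) / (1 - s) := by
  have hs1 : 0 < 1 - s := by linarith [hs.2]
  have hm : Measurable (fun z : E N => min ‖z‖ M) := by fun_prop
  rw [integral_eq_lintegral_of_nonneg_ae (Filter.Eventually.of_forall fun z => sq_nonneg _)
    (hm.pow_const 2).aestronglyMeasurable]
  refine ENNReal.toReal_le_of_le_ofReal (by positivity) ?_
  have h1 := lintegral_rpow_eq_lintegral_meas_lt_mul (jumpLaw N p s)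
    (f := fun z : E N => min ‖z‖ M)
    (Filter.Eventually.of_forall fun z => le_min (norm_nonneg z) hM.le) hm.aemeasurable
    (p := 2) two_pos
  simp only [Real.rpow_two] at h1
  rw [h1]
  have h2 : ∫⁻ t in Set.Ioi (0 : ℝ), jumpLaw N p s {z : E N | t < min ‖z‖ M} *
      ENNReal.ofReal (t ^ ((2 : ℝ) - 1)) ≤
      ∫⁻ t in Set.Ioc (0 : ℝ) M, ENNReal.ofReal (t ^ (1 - 2 * s)) := by
    rw [← lintegral_indicator measurableSet_Ioi, ← lintegral_indicator measurableSet_Ioc]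
    refine lintegral_mono fun t => ?_
    by_cases ht : t ∈ Set.Ioi (0 : ℝ)
    · rw [Set.indicator_of_mem ht]
      rcases le_or_gt M t with hMt | hMt
      · have : {z : E N | t < min ‖z‖ M} = ∅ := by
          ext z; simp [hMt]
        rw [this, measure_empty, zero_mul]
        exact zero_le
      · rw [Set.indicator_of_mem (show t ∈ Set.Ioc 0 M from ⟨ht, hMt.le⟩)]
        have ht0 : 0 < t := ht
        calc _ ≤ ENNReal.ofReal (t ^ (-(2 * s))) * ENNReal.ofReal (t ^ ((2 : ℝ) - 1)) := by
              gcongr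
              refine (measure_mono fun z hz => ?_).trans (jumpLaw_tail N p hN hs ht0)
              exact lt_of_lt_of_le (show t < min ‖z‖ M from hz) (min_le_left _ _)
          _ = _ := by
              rw [← ENNReal.ofReal_mul (by positivity), ← Real.rpow_add ht0]
              congr 2; ring
    · rw [Set.indicator_of_notMem ht]; exact zero_le
  have h3 : ∫⁻ t in Set.Ioc (0 : ℝ) M, ENNReal.ofReal (t ^ (1 - 2 * s)) =
      ENNReal.ofReal (M ^ (2 - 2 * s) / (2 - 2 * s)) := by
    have hint : IntervalIntegrable (fun t : ℝ => t ^ (1 - 2 * s)) volume 0 M :=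
      intervalIntegral.intervalIntegrable_rpow' (by linarith [hs.2])
    rw [← ofReal_integral_eq_lintegral_ofReal
      ((intervalIntegrable_iff_integrableOn_Ioc_of_le hM.le).1 hint),
      ← intervalIntegral.integral_of_le hM.le, integral_rpow (Or.inl (by linarith [hs.2])),
      Real.zero_rpow (by linarith)]
    · congr 1
      rw [sub_zero, show 1 - 2 * s + 1 = 2 - 2 * s by ring]
    · filter_upwards [ae_restrict_mem measurableSet_Ioc] with t ht
      exact Real.rpow_nonneg ht.1.le _
  calc _ ≤ ENNReal.ofReal 2 * ENNReal.ofReal (M ^ (2 - 2 * s) / (2 - 2 * s)) := by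
        rw [← h3]; gcongr
    _ = _ := by
        rw [← ENNReal.ofReal_mul two_pos.le]
        congr 1
        field_simp

/-- The density is radial, and an isometry that fixes `e₁` preserves both volume and the truncated
cone. -/
theorem measurePreserving_jumpLaw (N : ℕ) (p : ℝ) (hN : 2 ≤ N) (s : ℝ) (ρ : E N ≃ₗᵢ[ℝ] E N)
    (hρ : ρ (coordVec N 0) = coordVec N 0) :
    MeasurePreserving ρ (jumpLaw N p s) (jumpLaw N p s) := by
  have hT := (isOpen_truncCone N p hN).measurableSet
  have hm : Measurable ρ := ρ.continuous.measurable
  refine ⟨hm, Measure.ext fun A hA => ?_⟩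
  rw [Measure.map_apply hm hA, jumpLaw, cond_apply hT, cond_apply hT]
  congr 1
  have hTA : truncCone N p ∩ ρ ⁻¹' A = ρ ⁻¹' (truncCone N p ∩ A) := by
    ext z
    have : InnerProductGeometry.angle (coordVec N 0) (ρ z) =
        InnerProductGeometry.angle (coordVec N 0) z := by
      conv_lhs => rw [← hρ]
      exact ρ.toLinearIsometry.angle_map _ _
    simp [truncCone, this]
  rw [hTA, fracMeasure, withDensity_apply _ (hm (hT.inter hA)), withDensity_apply _ (hT.inter hA),
    ← ρ.measurePreserving.setLIntegral_comp_preimage (hT.inter hA) (by fun_prop)]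
  simp

/-- By symmetry, the mean of the jumps of length at most `M` is a multiple of `e₁`. -/
theorem exists_setIntegral_jumpLaw_eq (N : ℕ) (p : ℝ) (hN : 2 ≤ N) {s : ℝ}
    (hs : s ∈ Set.Ioo (1 / 2 : ℝ) 1) (M : ℝ) :
    ∃ m : ℝ, 0 ≤ m ∧ ∫ z in {z : E N | ‖z‖ ≤ M}, z ∂(jumpLaw N p s) = m • coordVec N 0 := by
  have hP := isProbabilityMeasure_jumpLaw N p hN hs
  have h1 := norm_coordVec (N := N) (k := 0) (by omega)
  have hB : MeasurableSet {z : E N | ‖z‖ ≤ M} := measurableSet_le (by fun_prop) (by fun_prop)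
  have hint : IntegrableOn (fun z : E N => z) {z : E N | ‖z‖ ≤ M} (jumpLaw N p s) := by
    refine Measure.integrableOn_of_bounded (M := M) (measure_ne_top _ _)
      measurable_id.aestronglyMeasurable ?_
    filter_upwards [ae_restrict_mem hB] with z hz using hz
  set I := ∫ z in {z : E N | ‖z‖ ≤ M}, z ∂(jumpLaw N p s) with hI
  -- Reflection in the line through `e₁`: its fixed vectors are exactly the multiples of `e₁`, so
  -- this single symmetry locates the mean.
  let ρ : E N ≃ₗᵢ[ℝ] E N := (Submodule.span ℝ {coordVec N 0}).reflection
  have hρ : ρ (coordVec N 0) = coordVec N 0 :=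
    (Submodule.reflection_eq_self_iff _).2 (Submodule.mem_span_singleton_self _)
  have hpre : ρ ⁻¹' {z : E N | ‖z‖ ≤ M} = {z : E N | ‖z‖ ≤ M} := by ext z; simp
  have hfix : ρ I = I := by
    have h2 := (measurePreserving_jumpLaw N p hN s ρ hρ).setIntegral_preimage_emb
      ρ.toHomeomorph.measurableEmbedding (fun z => z) {z : E N | ‖z‖ ≤ M}
    rw [hpre] at h2
    exact (ρ.toContinuousLinearEquiv.toContinuousLinearMap.integral_comp_comm hint).symm.trans h2
  obtain ⟨m, hm⟩ := Submodule.mem_span_singleton.1 ((Submodule.reflection_eq_self_iff _).1 hfix)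
  refine ⟨m, ?_, hm.symm⟩
  have h3 : inner ℝ (coordVec N 0) I = m := by
    rw [← hm, inner_smul_right, real_inner_self_eq_norm_sq, h1]; norm_num
  rw [← h3, hI, ← integral_inner hint]
  refine integral_nonneg_of_ae (ae_restrict_of_ae ?_)
  have := ae_cond_mem (μ := fracMeasure N s) (isOpen_truncCone N p hN).measurableSet
  filter_upwards [this] with z hz using (inner_pos_of_mem_truncCone hN hz).le

/-! ### The barrier and its submartingale property. -/

/-- The truncated power `max(|a|, c)^{-2k}`. -/
noncomputable def barrier {N : ℕ} (k : ℕ) (c : ℝ) (a : E N) : ℝ := ((max ‖a‖ c ^ 2)⁻¹) ^ k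

theorem measurable_barrier {N : ℕ} (k : ℕ) (c : ℝ) :
    Measurable (barrier k c : E N → ℝ) := by
  unfold barrier; fun_prop

theorem barrier_nonneg {N : ℕ} (k : ℕ) (c : ℝ) (a : E N) : 0 ≤ barrier k c a := by
  unfold barrier; positivity

theorem barrier_le {N : ℕ} (k : ℕ) {c d : ℝ} (hd : 0 < d) {a : E N} (h : d ≤ max ‖a‖ c) :
    barrier k c a ≤ ((d ^ 2)⁻¹) ^ k := by
  unfold barrier; gcongr

theorem le_barrier {N : ℕ} (k : ℕ) {c d : ℝ} (hc : 0 < c) {a : E N} (h : max ‖a‖ c ≤ d) :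
    ((d ^ 2)⁻¹) ^ k ≤ barrier k c a := by
  have : 0 < max ‖a‖ c := lt_max_of_lt_right hc
  unfold barrier; gcongr

theorem norm_add_sq_div {N : ℕ} {a u : E N} (ha : 0 < ‖a‖) :
    ‖a + u‖ ^ 2 = ‖a‖ ^ 2 * (1 + (2 * inner ℝ a u + ‖u‖ ^ 2) / ‖a‖ ^ 2) := by
  rw [norm_add_sq_real]; field_simp; ring

theorem max_norm_add {N : ℕ} {c : ℝ} {a u : E N} (hca : 2 * c ≤ ‖a‖) (hu : 2 * ‖u‖ ≤ ‖a‖) :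
    max ‖a + u‖ c = ‖a + u‖ := by
  refine max_eq_left ?_
  have := norm_sub_le (a + u) u
  rw [add_sub_cancel_right] at this
  linarith

/-- Here `|a + u| ≥ |a|/2 ≥ c`, so the truncation is inactive. The rest is Bernoulli's inequality
together with `(1 + b)⁻¹ ≥ 1 - b`. -/
theorem le_barrier_add {N : ℕ} (k : ℕ) {c : ℝ} {a u : E N} (ha : 0 < ‖a‖) (hca : 2 * c ≤ ‖a‖)
    (hu : 2 * ‖u‖ ≤ ‖a‖) :
    ((‖a‖ ^ 2)⁻¹) ^ k * (1 - k * ((2 * inner ℝ a u + ‖u‖ ^ 2) / ‖a‖ ^ 2)) ≤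
      barrier k c (a + u) := by
  have hau : 0 < ‖a + u‖ := by
    have := norm_sub_le (a + u) u
    rw [add_sub_cancel_right] at this
    linarith
  rw [barrier, max_norm_add hca hu, norm_add_sq_div ha, mul_inv, mul_pow]
  set b := (2 * inner ℝ a u + ‖u‖ ^ 2) / ‖a‖ ^ 2
  have hX : 0 < 1 + b := by
    have h0 : 0 < ‖a‖ ^ 2 * (1 + b) := by
      rw [← norm_add_sq_div ha]; positivity
    exact pos_of_mul_pos_right h0 (by positivity)
  refine mul_le_mul_of_nonneg_left ?_ (by positivity)
  have h1 : 1 + (k : ℝ) * ((1 + b)⁻¹ - 1) ≤ ((1 + b)⁻¹) ^ k :=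
    one_add_mul_sub_le_pow (by linarith [inv_pos.2 hX]) k
  have h2 : -b ≤ (1 + b)⁻¹ - 1 := by
    have : (1 + b)⁻¹ - 1 = -b + b ^ 2 / (1 + b) := by field_simp; ring
    rw [this]
    have : 0 ≤ b ^ 2 / (1 + b) := by positivity
    linarith
  have := mul_le_mul_of_nonneg_left h2 (Nat.cast_nonneg (α := ℝ) k)
  linarith

theorem le_barrier_add_of_toward {N : ℕ} (k : ℕ) {c : ℝ} {a u : E N} (hca : 2 * c ≤ ‖a‖)
    (h1 : ‖a‖ < 4 * ‖u‖) (h2 : 2 * ‖u‖ < ‖a‖) (h3 : inner ℝ a u ≤ -(3 / 4 * ‖a‖ * ‖u‖)) :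
    ((‖a‖ ^ 2)⁻¹) ^ k * (16 / 11) ^ k ≤ barrier k c (a + u) := by
  have ha : 0 < ‖a‖ := by linarith [norm_nonneg u]
  have hau : 0 < ‖a + u‖ := by
    have := norm_sub_le (a + u) u
    rw [add_sub_cancel_right] at this
    linarith
  rw [barrier, max_norm_add hca h2.le, ← mul_pow]
  refine pow_le_pow_left₀ (by positivity) ?_ k
  -- With `|u| = t |a|` the left side is at most `(1 - 3t/2 + t²) |a|²`. By convexity the maximum
  -- over `1/4 ≤ t ≤ 1/2` is at an endpoint, namely `11/16` at `t = 1/4`.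
  have h4 : ‖a + u‖ ^ 2 ≤ 11 / 16 * ‖a‖ ^ 2 := by
    rw [norm_add_sq_real]
    nlinarith [mul_pos (sub_pos.2 h1) (sub_pos.2 h2)]
  rw [← div_eq_inv_mul, div_le_iff₀ (by positivity), ← div_eq_inv_mul, le_div_iff₀ (by positivity)]
  linarith

/-- If Player I aims at the origin, then for large `k` the truncated power `max(|a|, c)^{-2k}` is a
submartingale off the origin, whatever Player II does. -/
theorem barrier_step (N : ℕ) (hN : 2 ≤ N) (p : ℝ) {s : ℝ} (hs : s ∈ Set.Ioo (1 / 2 : ℝ) 1) {k : ℕ}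
    (hk : 2 + k / (2 * (1 - s)) ≤
      ((16 / 11) ^ k - 1 - k) * (jumpLaw N p s).real (nearAxis N 2))
    {c : ℝ} (hc : 0 < c) {a : E N} (hca : 2 * c ≤ ‖a‖) {ε : ℝ} (hε : 0 < ε) (hεa : 4 * ε ≤ ‖a‖)
    {y : E N} (hy : ‖y‖ = 1) :
    2 * barrier k c a ≤ (∫ z, barrier k c (a + ε • rot (-(‖a‖⁻¹ • a)) z) ∂(jumpLaw N p s)) +
      ∫ z, barrier k c (a + ε • rot y z) ∂(jumpLaw N p s) := by
  have hP := isProbabilityMeasure_jumpLaw N p hN hs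
  have hs1 : 0 < 1 - s := by linarith [hs.2]
  have hs0 : 0 < s := by linarith [hs.1]
  set Q := jumpLaw N p s with hQ
  set ρ := ‖a‖ with hρ
  have hρ0 : 0 < ρ := by linarith
  -- The jumps with `|z| ≤ M` are those that move the position by at most `ρ/2`.
  set M := ρ / (2 * ε) with hMdef
  have hM : 2 ≤ M := by rw [hMdef, le_div_iff₀ (by positivity)]; linarith
  have hM0 : 0 < M := by linarith
  have hεM : ε * M = ρ / 2 := by rw [hMdef]; field_simp
  set K : ℝ := (16 / 11) ^ k - 1 - k with hK
  set c₁ := Q.real (nearAxis N 2) with hc₁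
  have hK0 : 0 < K := by
    have h0 : (0 : ℝ) ≤ k / (2 * (1 - s)) := by positivity
    exact pos_of_mul_pos_left (by linarith) (measureReal_nonneg)
  let B : Set (E N) := {z | ‖z‖ ≤ M}
  have hB : MeasurableSet B := measurableSet_le (by fun_prop) (by fun_prop)
  have hS : MeasurableSet (nearAxis N M) := (isOpen_nearAxis N M).measurableSet
  obtain ⟨m, hm0, hm⟩ := exists_setIntegral_jumpLaw_eq N p hN hs M
  let ℓ : E N → (E N →L[ℝ] ℝ) := fun y =>
    (innerSL ℝ a).comp (rot y).toContinuousLinearEquiv.toContinuousLinearMap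
  have hℓ : ∀ y z, ℓ y z = inner ℝ a (rot y z) := fun _ _ => rfl
  -- Lower bound for the barrier after the jump, relative to its present value. On `B` it is the
  -- bound of `le_barrier_add`, as `ε² / ρ² = 1 / (4 M²)`; off `B` it is nonpositive.
  let L : E N → E N → ℝ := fun y z => B.indicator (1 : E N → ℝ) z -
    (2 * k * ε / ρ ^ 2) * ℓ y (B.indicator (fun z => z) z) - k / (4 * M ^ 2) * (min ‖z‖ M) ^ 2
  -- the integral of the lower bound
  have i1 : Integrable (B.indicator (1 : E N → ℝ)) Q := (integrable_const (1 : ℝ)).indicator hB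
  have i2 : Integrable (B.indicator (fun z : E N => z)) Q := by
    refine (integrable_indicator_iff hB).2 (Measure.integrableOn_of_bounded (M := M)
      (measure_ne_top _ _) measurable_id.aestronglyMeasurable ?_)
    filter_upwards [ae_restrict_mem hB] with z hz using hz
  have i3 : Integrable (fun z : E N => (min ‖z‖ M) ^ 2) Q := by
    refine Integrable.of_bound (C := M ^ 2) (by fun_prop) (Filter.Eventually.of_forall fun z => ?_)
    rw [Real.norm_of_nonneg (sq_nonneg _)]
    exact pow_le_pow_left₀ (le_min (norm_nonneg z) hM0.le) (min_le_right _ _) 2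
  have i2' : ∀ y, Integrable (fun z => ℓ y (B.indicator (fun z => z) z)) Q := fun y =>
    (ℓ y).integrable_comp i2
  have iL : ∀ y, Integrable (L y) Q := fun y =>
    (i1.sub ((i2' y).const_mul _)).sub (i3.const_mul _)
  have hint : ∀ y : E N, ‖y‖ = 1 → ∫ z, L y z ∂Q = Q.real B -
      (2 * k * ε / ρ ^ 2) * (m * inner ℝ a y) -
      k / (4 * M ^ 2) * ∫ z, (min ‖z‖ M) ^ 2 ∂Q := by
    intro y hy
    have h1 : ∫ z, ℓ y (B.indicator (fun z => z) z) ∂Q = m * inner ℝ a y := by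
      rw [(ℓ y).integral_comp_comm i2, integral_indicator hB, hm, map_smul, hℓ,
        rot_coordVec_zero hN hy, smul_eq_mul]
    rw [← h1, ← integral_const_mul, ← integral_const_mul, ← integral_indicator_one hB]
    rw [← integral_sub i1 ((i2' y).const_mul _)]
    exact integral_sub (i1.sub ((i2' y).const_mul _)) (i3.const_mul _)
  -- pointwise bounds
  have hw0 : (0 : ℝ) ≤ ((ρ ^ 2)⁻¹) ^ k := by positivity
  have hLin : ∀ y z, z ∈ B → L y z = 1 - k * ((2 * inner ℝ a (ε • rot y z) +
      ‖ε • rot y z‖ ^ 2) / ρ ^ 2) := by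
    intro y z hz
    have hz' : ‖z‖ ≤ M := hz
    simp only [L, Set.indicator_of_mem hz, Pi.one_apply, min_eq_left hz', hℓ, inner_smul_right, norm_smul,
      LinearIsometryEquiv.norm_map, Real.norm_of_nonneg hε.le]
    rw [hMdef]
    field_simp
    ring
  have hball : ∀ y z, z ∈ B → 2 * ‖ε • rot y z‖ ≤ ρ := by
    intro y z hz
    have hz' : ‖z‖ ≤ M := hz
    rw [norm_smul, LinearIsometryEquiv.norm_map, Real.norm_of_nonneg hε.le]
    have := mul_le_mul_of_nonneg_left hz' hε.le
    linarith
  have hpt : ∀ y z, ((ρ ^ 2)⁻¹) ^ k * L y z ≤ barrier k c (a + ε • rot y z) := by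
    intro y z
    by_cases hz : z ∈ B
    · rw [hLin y z hz]
      exact le_barrier_add k hρ0 hca (hball y z hz)
    · refine le_trans (mul_nonpos_of_nonneg_of_nonpos hw0 ?_) (barrier_nonneg _ _ _)
      simp only [L, Set.indicator_of_notMem hz, map_zero, mul_zero, sub_zero, zero_sub]
      have : 0 ≤ (k : ℝ) / (4 * M ^ 2) * (min ‖z‖ M) ^ 2 := by positivity
      linarith
  set y₀ : E N := -(ρ⁻¹ • a) with hy₀def
  have hy₀ : ‖y₀‖ = 1 := by
    rw [hy₀def, norm_neg, norm_smul, norm_inv, Real.norm_of_nonneg hρ0.le]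
    exact inv_mul_cancel₀ hρ0.ne'
  have ha0 : a = -(ρ • y₀) := by
    rw [hy₀def, smul_neg, neg_neg, smul_inv_smul₀ hρ0.ne']
  have hay₀ : inner ℝ a y₀ = -ρ := by
    conv_lhs => rw [ha0]
    rw [inner_neg_left, real_inner_smul_left, real_inner_self_eq_norm_sq, hy₀]; ring
  have hpt₀ : ∀ z, ((ρ ^ 2)⁻¹) ^ k * (L y₀ z + K * (nearAxis N M).indicator 1 z) ≤
      barrier k c (a + ε • rot y₀ z) := by
    intro z
    by_cases hz : z ∈ nearAxis N M
    · obtain ⟨hz1, hz2, hz3⟩ := hz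
      have hzB : z ∈ B := hz2.le
      have hn : ‖ε • rot y₀ z‖ = ε * ‖z‖ := by
        rw [norm_smul, LinearIsometryEquiv.norm_map, Real.norm_of_nonneg hε.le]
      have hz1' := mul_lt_mul_of_pos_left hz1 hε
      have hz2' := mul_lt_mul_of_pos_left hz2 hε
      have hin : inner ℝ a (rot y₀ z) = -(ρ * inner ℝ (coordVec N 0) z) := by
        conv_lhs => rw [ha0]
        rw [inner_neg_left, real_inner_smul_left]
        have := (rot y₀).inner_map_map (coordVec N 0) z
        rw [rot_coordVec_zero hN hy₀] at this
        rw [this]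
      have hin' : inner ℝ a (ε • rot y₀ z) ≤ -(3 / 4 * ρ * ‖ε • rot y₀ z‖) := by
        rw [hn, inner_smul_right, hin]
        have := mul_lt_mul_of_pos_left hz3 (mul_pos hε hρ0)
        linarith
      refine le_trans ?_ (le_barrier_add_of_toward k hca (u := ε • rot y₀ z)
        (by rw [hn]; linarith) (by rw [hn]; linarith) hin')
      refine mul_le_mul_of_nonneg_left ?_ hw0
      have hcs := neg_le_of_abs_le (abs_real_inner_le_norm a (ε • rot y₀ z))
      have hb := hball y₀ z hzB
      -- Hence `L y₀ z ≤ 1 + k`, so adding `K` gives at most `(16/11)^k`, the gain of a jump towards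
      -- the origin.
      have : -1 ≤ (2 * inner ℝ a (ε • rot y₀ z) + ‖ε • rot y₀ z‖ ^ 2) / ρ ^ 2 := by
        rw [le_div_iff₀ (by positivity)]
        nlinarith [sq_nonneg ‖ε • rot y₀ z‖]
      have := mul_le_mul_of_nonneg_left this (Nat.cast_nonneg (α := ℝ) k)
      rw [hLin y₀ z hzB, Set.indicator_of_mem (show z ∈ nearAxis N M from ⟨hz1, hz2, hz3⟩), hK,
        Pi.one_apply]
      linarith
    · rw [Set.indicator_of_notMem hz, mul_zero, add_zero]
      exact hpt y₀ z
  -- integration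
  have iB : ∀ y, Integrable (fun z => barrier k c (a + ε • rot y z)) Q := by
    intro y
    have hm : Measurable (fun z => barrier k c (a + ε • rot y z)) :=
      (measurable_barrier k c).comp
        (((rot y).continuous.measurable.const_smul ε).const_add a)
    refine Integrable.of_bound (C := ((c ^ 2)⁻¹) ^ k) hm.aestronglyMeasurable
      (Filter.Eventually.of_forall fun z => ?_)
    rw [Real.norm_of_nonneg (barrier_nonneg _ _ _)]
    exact barrier_le k hc (le_max_right _ _)
  have iS : Integrable ((nearAxis N M).indicator (1 : E N → ℝ)) Q :=
    (integrable_const (1 : ℝ)).indicator hS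
  have e1 : ((ρ ^ 2)⁻¹) ^ k * (∫ z, L y z ∂Q) ≤ ∫ z, barrier k c (a + ε • rot y z) ∂Q := by
    rw [← integral_const_mul]
    exact integral_mono ((iL y).const_mul _) (iB y) (hpt y)
  have e2 : ((ρ ^ 2)⁻¹) ^ k * ((∫ z, L y₀ z ∂Q) + K * Q.real (nearAxis N M)) ≤
      ∫ z, barrier k c (a + ε • rot y₀ z) ∂Q := by
    rw [← integral_indicator_one hS, ← integral_const_mul, ← integral_add (iL y₀) (iS.const_mul K),
      ← integral_const_mul]
    exact integral_mono (((iL y₀).add (iS.const_mul K)).const_mul _) (iB y₀) hpt₀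
  have e3 : barrier k c a = ((ρ ^ 2)⁻¹) ^ k := by
    rw [barrier, max_eq_left (by linarith)]
  -- estimates of the three terms
  set T := M ^ (-(2 * s)) with hT
  have hT0 : 0 < T := Real.rpow_pos_of_pos hM0 _
  have f1 : 1 - T ≤ Q.real B := by
    have hcompl : Bᶜ = {z : E N | M < ‖z‖} := by ext z; simp [B]
    have h1 : Q.real Bᶜ ≤ T := by
      rw [hcompl]
      exact ENNReal.toReal_le_of_le_ofReal hT0.le (jumpLaw_tail N p hN hs hM0)
    rw [probReal_compl_eq_one_sub hB] at h1
    linarith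
  have f2 : k / (4 * M ^ 2) * ∫ z, (min ‖z‖ M) ^ 2 ∂Q ≤ T * (k / (4 * (1 - s))) := by
    have h1 := integral_min_norm_sq_le N p hN hs hM0
    have h2 : M ^ (2 - 2 * s) = M ^ 2 * T := by
      rw [hT, ← Real.rpow_two, ← Real.rpow_add hM0]; ring_nf
    rw [h2] at h1
    refine (mul_le_mul_of_nonneg_left h1 (by positivity)).trans_eq ?_
    field_simp
  have f3 : T * c₁ ≤ Q.real (nearAxis N M) := by
    rw [measureReal_def, jumpLaw_nearAxis N p hN s hM, ENNReal.toReal_mul,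
      ENNReal.toReal_ofReal (by positivity), hc₁, measureReal_def]
    refine mul_le_mul_of_nonneg_right ?_ ENNReal.toReal_nonneg
    exact Real.rpow_le_rpow_of_nonpos (by positivity) (by linarith) (by linarith)
  -- The combined drift of the two players: aiming at the origin is worth `ρ`, and no unit vector
  -- `y` can undo more.
  have f4 : 0 ≤ (2 * k * ε / ρ ^ 2) * (m * (ρ - inner ℝ a y)) := by
    have : inner ℝ a y ≤ ρ := by
      have := real_inner_le_norm a y
      rwa [hy, mul_one] at this
    have : 0 ≤ ρ - inner ℝ a y := by linarith
    positivity
  have f5 := mul_le_mul_of_nonneg_left f3 hK0.le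
  have f6 := mul_le_mul_of_nonneg_left hk hT0.le
  have f7 : T * (2 + k / (2 * (1 - s))) = 2 * T + 2 * (T * (k / (4 * (1 - s)))) := by
    field_simp; ring
  have total : 2 ≤ ((∫ z, L y₀ z ∂Q) + K * Q.real (nearAxis N M)) + ∫ z, L y z ∂Q := by
    rw [hint y hy, hint y₀ hy₀, hay₀]
    linarith
  have := mul_le_mul_of_nonneg_left total hw0
  rw [e3]
  linarith

theorem exists_exponent {s : ℝ} (hs : s < 1) {c : ℝ} (hc : 0 < c) :
    ∃ k : ℕ, 1 ≤ k ∧ 2 + (k : ℝ) / (2 * (1 - s)) ≤ ((16 / 11) ^ k - 1 - k) * c := by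
  have hs1 : 0 < 1 - s := by linarith
  set A : ℝ := 2 + c + (1 / (2 * (1 - s)) + c) with hA
  have hA0 : 0 < A := by positivity
  -- `k / (16/11)^k` tends to `0`, so eventually `k A < (16/11)^k c`; for `k ≥ 1` the term `k A`
  -- absorbs all constant and linear terms.
  have h1 := tendsto_pow_const_div_const_pow_of_one_lt 1 (r := (16 / 11 : ℝ)) (by norm_num)
  obtain ⟨k, hk, hk1⟩ := ((h1.eventually (gt_mem_nhds (div_pos hc hA0))).and
    (Filter.eventually_ge_atTop 1)).exists
  refine ⟨k, hk1, ?_⟩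
  rw [pow_one, div_lt_div_iff₀ (by positivity) hA0] at hk
  have hk1' : (1 : ℝ) ≤ k := by exact_mod_cast hk1
  have h2 : 2 + (k : ℝ) / (2 * (1 - s)) + c + k * c ≤ k * A := by
    have : (k : ℝ) * A = (2 + c) * k + k / (2 * (1 - s)) + k * c := by rw [hA]; ring
    rw [this]
    nlinarith
  linarith

/-! ### Aiming at a point, and the resulting exit estimate. -/

open Classical in
/-- The unit vector that points from `x` to `z₀` (and `e₁` if `x = z₀`). -/
noncomputable def unitToward {N : ℕ} (hN : 2 ≤ N) (z₀ x : E N) : Metric.sphere (0 : E N) 1 :=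
  ⟨if x = z₀ then coordVec N 0 else -(‖x - z₀‖⁻¹ • (x - z₀)), by
    rw [mem_sphere_zero_iff_norm]
    split_ifs with h
    · exact norm_coordVec (by omega)
    · rw [norm_neg, norm_smul, norm_inv, norm_norm]
      exact inv_mul_cancel₀ (norm_ne_zero_iff.2 (sub_ne_zero.2 h))⟩

theorem measurable_unitToward {N : ℕ} (hN : 2 ≤ N) (z₀ : E N) :
    Measurable (unitToward hN z₀) :=
  Measurable.subtype_mk (Measurable.ite (measurableSet_singleton z₀) measurable_const
    (by fun_prop))

/-- The strategy of always aiming at `z₀`. -/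
noncomputable def aimStrategy {N : ℕ} (hN : 2 ≤ N) (z₀ : E N) : Strategy N where
  dir _ H := unitToward hN z₀ H.pos
  measurable_dir n := (measurable_unitToward hN z₀).comp (History.measurable_pos n)

theorem mem_of_lt_exitTime {N : ℕ} {D : Set (E N)} {ε : ℝ} {x : E N} {σI σII : Strategy N}
    {ω : ℕ → Outcome N} {n k : ℕ} (hx : x ∈ D) (h : (n : ℕ∞) < exitTime D ε x σI σII ω)
    (hk : k ≤ n) : position ε x σI σII k ω ∈ D := by
  by_contra hD
  rcases Nat.eq_zero_or_pos k with rfl | hk0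
  -- The exit time ignores time `0`, so the starting point is treated separately.
  · exact hD hx
  · have : exitTime D ε x σI σII ω ≤ (k : ℕ∞) := iInf₂_le k ⟨hk0, hD⟩
    exact absurd (h.trans_le this) (not_lt.2 (by exact_mod_cast hk))

theorem exists_first_exit {N : ℕ} {D U : Set (E N)} {ε : ℝ} {x : E N} {σI σII : Strategy N}
    {ω : ℕ → Outcome N} {n : ℕ} (hx : x ∈ D) (h : (n : ℕ∞) < exitTime D ε x σI σII ω)
    (hn : position ε x σI σII n ω ∉ U) :
    ∃ n, (∀ k < n, position ε x σI σII k ω ∈ D ∩ U) ∧ position ε x σI σII n ω ∈ D \ U := by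
  classical
  have hex : ∃ n, position ε x σI σII n ω ∉ U := ⟨n, hn⟩
  have hle : Nat.find hex ≤ n := Nat.find_min' hex hn
  refine ⟨Nat.find hex, fun k hk => ⟨mem_of_lt_exitTime hx h (hk.le.trans hle), ?_⟩,
    mem_of_lt_exitTime hx h hle, Nat.find_spec hex⟩
  exact not_not.1 (Nat.find_min hex hk)

/-- If `D` avoids the ball of radius `κ r` about `z₀`, then by aiming at `z₀` Player I keeps the
probability of leaving `U` before `D` under control. -/
theorem measure_leave_le (N : ℕ) (hN : 2 ≤ N) (p : ℝ) {s : ℝ} (hs : s ∈ Set.Ioo (1 / 2 : ℝ) 1)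
    {k : ℕ} (hk : 2 + k / (2 * (1 - s)) ≤
      ((16 / 11) ^ k - 1 - k) * (jumpLaw N p s).real (nearAxis N 2))
    {κ r : ℝ} (hκ : 0 < κ) (hκ1 : κ ≤ 1) (hr : 0 < r) {D U : Set (E N)} (hD : MeasurableSet D)
    (hU : MeasurableSet U) {z₀ x₀ : E N} (hz₀ : ∀ X ∈ D, κ * r ≤ ‖X - z₀‖)
    (hDU : ∀ X ∈ D, X ∉ U → 4 * r ≤ ‖X - z₀‖) (hx₀ : x₀ ∈ D) (hx₀z : ‖x₀ - z₀‖ ≤ 2 * r)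
    {ε : ℝ} (hε : 0 < ε) (hεr : 4 * ε ≤ κ * r) (σII : Strategy N) :
    (gameLaw N p s).real {ω | ∃ n : ℕ, (n : ℕ∞) < exitTime D ε x₀ (aimStrategy hN z₀) σII ω ∧
      position ε x₀ (aimStrategy hN z₀) σII n ω ∉ U} ≤
      1 - ((κ ^ 2 / 16) ^ k - (κ ^ 2 / 64) ^ k) := by
  have hP := isProbabilityMeasure_jumpLaw N p hN hs
  set c := κ * r / 2 with hc
  have hκr : 0 < κ * r := by positivity
  have hc0 : 0 < c := by positivity
  have hcr : c ≤ r := by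
    have := mul_le_mul_of_nonneg_right hκ1 hr.le
    rw [hc]; linarith
  set C₁ : ℝ := (c ^ 2) ^ k with hC₁
  -- `C₁` scales the barrier to have maximum at most `1`, which keeps `f` nonnegative; `C₀` is
  -- chosen so that `f ≥ 1` at distance at least `4 r` from `z₀`.
  set C₀ : ℝ := 1 + C₁ * (((4 * r) ^ 2)⁻¹) ^ k with hC₀
  have hC₁0 : 0 < C₁ := by positivity
  let f : E N → ℝ := fun X => C₀ - C₁ * barrier k c (X - z₀)
  have hbar : ∀ a : E N, C₁ * barrier k c a ≤ 1 := by
    intro a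
    refine (mul_le_mul_of_nonneg_left (barrier_le k hc0 (le_max_right _ _)) hC₁0.le).trans_eq ?_
    rw [hC₁, ← mul_pow, mul_inv_cancel₀ (by positivity), one_pow]
  have hf0 : ∀ X, 0 ≤ f X := by
    intro X
    have h1 := hbar (X - z₀)
    have h2 : 0 ≤ C₁ * (((4 * r) ^ 2)⁻¹) ^ k := by positivity
    simp only [f]
    linarith
  have hfm : Measurable f :=
    measurable_const.sub (((measurable_barrier k c).comp (measurable_id.sub_const z₀)).const_mul C₁)
  have hlin : ∀ (X y : E N), Integrable (fun z => barrier k c (X - z₀ + ε • rot y z))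
      (jumpLaw N p s) := by
    intro X y
    have hm : Measurable (fun z => barrier k c (X - z₀ + ε • rot y z)) :=
      (measurable_barrier k c).comp
        (((rot y).continuous.measurable.const_smul ε).const_add (X - z₀))
    refine Integrable.of_bound (C := ((c ^ 2)⁻¹) ^ k) hm.aestronglyMeasurable
      (Filter.Eventually.of_forall fun z => ?_)
    rw [Real.norm_of_nonneg (barrier_nonneg _ _ _)]
    exact barrier_le k hc0 (le_max_right _ _)
  have hl : ∀ X y : E N, ∫⁻ z, ENNReal.ofReal (f (X + ε • rot y z)) ∂(jumpLaw N p s) =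
      ENNReal.ofReal (C₀ - C₁ * ∫ z, barrier k c (X - z₀ + ε • rot y z) ∂(jumpLaw N p s)) := by
    intro X y
    have h1 : (fun z => f (X + ε • rot y z)) =
        fun z => C₀ - C₁ * barrier k c (X - z₀ + ε • rot y z) := by
      funext z; simp only [f, add_sub_right_comm]
    have h2 : Integrable (fun z => f (X + ε • rot y z)) (jumpLaw N p s) := by
      rw [h1]; exact (integrable_const C₀).sub ((hlin X y).const_mul C₁)
    rw [← ofReal_integral_eq_lintegral_ofReal h2 (Filter.Eventually.of_forall fun z => hf0 _), h1,
      integral_sub (integrable_const C₀) ((hlin X y).const_mul C₁), integral_const_mul]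
    simp
  have hI0 : ∀ X y : E N,
      0 ≤ C₀ - C₁ * ∫ z, barrier k c (X - z₀ + ε • rot y z) ∂(jumpLaw N p s) := by
    intro X y
    have h1 : ∫ z, C₁ * barrier k c (X - z₀ + ε • rot y z) ∂(jumpLaw N p s) ≤
        ∫ _, (1 : ℝ) ∂(jumpLaw N p s) :=
      integral_mono ((hlin X y).const_mul C₁) (integrable_const 1) fun z => hbar _
    rw [integral_const_mul] at h1
    simp only [integral_const, probReal_univ, smul_eq_mul, mul_one] at h1
    have h2 : 0 ≤ C₁ * (((4 * r) ^ 2)⁻¹) ^ k := by positivity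
    linarith
  have hkey := measure_enter_le hN p hs ε (G := D ∩ U) (K := D \ U) (hD.inter hU) (hD.diff hU)
    (Set.disjoint_left.2 fun X h1 h2 => h2.2 h1.2) (v := fun X => ENNReal.ofReal (f X))
    hfm.ennreal_ofReal (fun X hX => by
      rw [ENNReal.one_le_ofReal]
      have h1 := hDU X hX.1 hX.2
      have h2 := mul_le_mul_of_nonneg_left
        (barrier_le k (c := c) (by positivity : 0 < 4 * r) (h1.trans (le_max_left _ _))) hC₁0.le
      simp only [f]
      linarith)
    (unitToward hN z₀) (fun X hX y hy => by
      have hX1 := hz₀ X hX.1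
      have hne : X ≠ z₀ := by
        rintro rfl
        rw [sub_self, norm_zero] at hX1
        linarith
      have hstep := barrier_step N hN p hs hk hc0 (a := X - z₀) (by rw [hc]; linarith) hε
        (by linarith) hy
      simp only [hl, unitToward, if_neg hne]
      have h2 : 2 * ENNReal.ofReal (f X) = ENNReal.ofReal (2 * f X) := by
        rw [ENNReal.ofReal_mul two_pos.le, ENNReal.ofReal_ofNat]
      rw [← ENNReal.ofReal_add (hI0 _ _) (hI0 _ _), h2]
      refine ENNReal.ofReal_le_ofReal ?_
      have := mul_le_mul_of_nonneg_left hstep hC₁0.le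
      simp only [f]
      linarith)
    x₀ (aimStrategy hN z₀) σII (fun n H => rfl)
  -- The ratios `c / (2r) = κ/4` and `c / (4r) = κ/8` do not involve `r`, so the bound is
  -- independent of the scale.
  have hv : f x₀ ≤ 1 - ((κ ^ 2 / 16) ^ k - (κ ^ 2 / 64) ^ k) := by
    have h1 := mul_le_mul_of_nonneg_left
      (le_barrier k hc0 (max_le hx₀z (by linarith : c ≤ 2 * r))) hC₁0.le
    have h2 : C₁ * (((2 * r) ^ 2)⁻¹) ^ k = (κ ^ 2 / 16) ^ k := by
      rw [hC₁, ← mul_pow, hc]; congr 1; field_simp; norm_num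
    have h3 : C₁ * (((4 * r) ^ 2)⁻¹) ^ k = (κ ^ 2 / 64) ^ k := by
      rw [hC₁, ← mul_pow, hc]; congr 1; field_simp; norm_num
    rw [h2] at h1
    simp only [f, hC₀, h3]
    linarith
  refine le_trans ?_ hv
  refine ENNReal.toReal_le_of_le_ofReal (hf0 x₀) (le_trans (measure_mono ?_) hkey)
  rintro ω ⟨n, hn, hnU⟩
  exact exists_first_exit hx₀ hn hnU

/-! ### A ball inside the cone, and the conclusion. -/

theorem exists_angle_lt_of_norm_sub_lt {N : ℕ} {v : E N} (hv : ‖v‖ = 1) {β : ℝ} (hβ : 0 < β) :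
    ∃ κ : ℝ, 0 < κ ∧ κ ≤ 1 ∧ ∀ w : E N, ‖w - v‖ < κ → InnerProductGeometry.angle v w < β := by
  have hv0 : v ≠ 0 := by
    rw [← norm_ne_zero_iff, hv]; exact one_ne_zero
  have hc : ContinuousAt (fun w : E N => InnerProductGeometry.angle v w) v :=
    (InnerProductGeometry.continuousAt_angle (x := (v, v)) hv0 hv0).comp
      (f := fun w : E N => (v, w)) (by fun_prop)
  have h1 := hc.eventually (gt_mem_nhds
    (show InnerProductGeometry.angle v v < β by rwa [InnerProductGeometry.angle_self hv0]))
  obtain ⟨κ, hκ, h2⟩ := Metric.eventually_nhds_iff.1 h1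
  refine ⟨min κ 1, lt_min hκ one_pos, min_le_right _ _, fun w hw => h2 ?_⟩
  rw [dist_eq_norm]
  exact hw.trans_le (min_le_left _ _)

theorem mem_finiteCone_of_norm_sub_lt {N : ℕ} {v : E N} (hv : ‖v‖ = 1) {β h κ r : ℝ}
    (hκ1 : κ ≤ 1) (hκ : ∀ w : E N, ‖w - v‖ < κ → InnerProductGeometry.angle v w < β) (hr : 0 < r)
    (hrh : 2 * r ≤ h) {z : E N} (hz : ‖z - r • v‖ < κ * r) : z ∈ finiteCone v β h := by
  have hrv : ‖r • v‖ = r := by rw [norm_smul, hv, Real.norm_of_nonneg hr.le, mul_one]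
  have hκr := mul_le_mul_of_nonneg_right hκ1 hr.le
  refine ⟨?_, ?_, ?_⟩
  · rw [← InnerProductGeometry.angle_smul_right_of_pos v z (inv_pos.2 hr)]
    refine hκ _ ?_
    have : r⁻¹ • z - v = r⁻¹ • (z - r • v) := by rw [smul_sub, inv_smul_smul₀ hr.ne']
    rw [this, norm_smul, Real.norm_of_nonneg (inv_pos.2 hr).le, inv_mul_eq_div, div_lt_iff₀ hr]
    exact hz
  · have := norm_sub_norm_le (r • v) z
    rw [norm_sub_rev, hrv] at this
    linarith
  · have := norm_sub_norm_le z (r • v)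
    rw [hrv] at this
    linarith

end FracTug

theorem theorem7p2 (N : ℕ) (hN : 2 ≤ N) (p : ℝ) (hp : 2 ≤ p) (s : ℝ)
    (hs : s ∈ Set.Ioo (1 / 2 : ℝ) 1) (v : FracTug.E N) (hv : ‖v‖ = 1) (β : ℝ)
    (hβ : β ∈ Set.Ioo 0 Real.pi) (h : ℝ) (hh : 0 < h) :
    ∃ θ : ℝ, θ < 1 ∧
      ∀ D : Set (FracTug.E N), IsOpen D → Bornology.IsBounded D →
        FracTug.ExternalCone D (FracTug.finiteCone v β h) →
        ∀ δ : ℝ, 0 < δ →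
          ∃ δ' : ℝ, 0 < δ' ∧ δ' < δ ∧ ∃ ε' : ℝ, 0 < ε' ∧
            ∀ ε : ℝ, 0 < ε → ε < ε' →
              ∀ x ∈ frontier D, ∀ x₀ ∈ Metric.ball x δ' ∩ D,
                ∃ σI : FracTug.Strategy N, ∀ σII : FracTug.Strategy N,
                  (FracTug.gameLaw N p s).real
                    {ω | ∃ n : ℕ,
                      (n : ℕ∞) < FracTug.exitTime D ε x₀ σI σII ω ∧
                        FracTug.position ε x₀ σI σII n ω ∉ Metric.ball x δ} ≤ θ := by
  have hP := FracTug.isProbabilityMeasure_jumpLaw N p hN hs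
  have hc : 0 < (FracTug.jumpLaw N p s).real (FracTug.nearAxis N 2) :=
    ENNReal.toReal_pos (FracTug.jumpLaw_nearAxis_pos N p hN hs) (measure_ne_top _ _)
  obtain ⟨k, hk1, hk⟩ := FracTug.exists_exponent hs.2 hc
  obtain ⟨κ, hκ, hκ1, hκβ⟩ := FracTug.exists_angle_lt_of_norm_sub_lt hv hβ.1
  refine ⟨1 - ((κ ^ 2 / 16) ^ k - (κ ^ 2 / 64) ^ k), ?_, ?_⟩
  · have : (κ ^ 2 / 64) ^ k < (κ ^ 2 / 16) ^ k :=
      pow_lt_pow_left₀ (by nlinarith [sq_pos_of_pos hκ]) (by positivity) (by omega)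
    linarith
  intro D hDo _ hD δ hδ
  -- Small against `h`, so that the ball of radius `κ r` about `r • v` lies in the cone; small
  -- against `δ`, so that points outside `B_δ(x)` are at distance at least `8 r - r ≥ 4 r` from
  -- `z₀`.
  set r := min δ h / 8 with hr
  have hr0 : 0 < r := by have := lt_min hδ hh; positivity
  have hrδ : 8 * r ≤ δ := by rw [hr]; linarith [min_le_left δ h]
  have hrh : 8 * r ≤ h := by rw [hr]; linarith [min_le_right δ h]
  -- Starting within `r` of `x` gives distance at most `2 r` to `z₀`; the bound on `ε` ensures `M ≥
  -- 2` in `barrier_step` at every point of `D`.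
  refine ⟨r, hr0, by linarith, κ * r / 4, by positivity, ?_⟩
  rintro ε hε hεr x hx x₀ ⟨hx₀, hx₀D⟩
  obtain ⟨S, -, hS⟩ := hD x hx
  set z₀ := x + S (r • v) with hz₀
  have hxz : ‖x - z₀‖ = r := by
    rw [hz₀, sub_add_cancel_left, norm_neg, LinearIsometryEquiv.norm_map, norm_smul, hv,
      Real.norm_of_nonneg hr0.le, mul_one]
  refine ⟨FracTug.aimStrategy hN z₀, fun σII => ?_⟩
  refine FracTug.measure_leave_le N hN p hs hk hκ hκ1 hr0 hDo.measurableSet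
    measurableSet_ball (z₀ := z₀) ?_ ?_ hx₀D ?_ hε (by linarith) σII
  · intro X hX
    by_contra! hlt
    refine hS (S.symm (X - x)) (FracTug.mem_finiteCone_of_norm_sub_lt hv hκ1 hκβ hr0 (by linarith)
      ?_) (by simpa using hX)
    rw [← S.norm_map, map_sub, LinearIsometryEquiv.apply_symm_apply, sub_sub, ← hz₀]
    exact hlt
  · intro X _ hX
    rw [Metric.mem_ball, not_lt, dist_eq_norm] at hX
    have := norm_sub_le_norm_sub_add_norm_sub X z₀ x
    rw [norm_sub_rev z₀ x, hxz] at this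
    linarith
  · rw [Metric.mem_ball, dist_eq_norm] at hx₀
    have := norm_sub_le_norm_sub_add_norm_sub x₀ x z₀
    rw [hxz] at this
    linarith
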